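/- **Setting.** Let $\mathcal L_\beta$ and $\mathcal L_\alpha$ be first-order languages such that every function symbol of $\mathcal L_\alpha$ (constants are nullary functions) belongs to $\mathcal L_\beta$; let $\mathcal L=\mathcal L_\alpha\cap\mathcal L_\beta$ and $\mathcal L^2=\mathcal L_\beta\cup\mathcal L_\alpha\cup\{A\}$ with $A$ a new unary predicate. Let $T_\beta$ be a consistent $\mathcal L_\beta$-theory and $T_\alpha$ a consistent $\mathcal L_\alpha$-theory. Assume that $T_\beta$ is *geometric*: it eliminates $\exists^\infty$, and $\operatorname{acl}$ defines a pregeometry in every model of $T_\beta$. For an $\mathcal L_\alpha$-formula $\theta$ let $\theta_A$ be the formula obtained by relativizing all quantifiers to $A$. Let $T^2$ be the $\mathcal L^2$-theory axiomatized by $T_\beta$, all $\phi_A$ with $T_\alpha\models\phi$, the axioms saying that $A$ is closed under each function symbol of $\mathcal L_\alpha$, and the axioms $R(x_1,\dots,x_n)\to\bigwedge_i A(x_i)$ for each relation symbol $R\in\mathcal L_\alpha\setminus\mathcal L_\beta$. A model of $T^2$ is written $(\mathcal B,\mathcal A)$, where $\mathcal B$ (with universe $B$) is its reduct to $\mathcal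 L_\beta$ and $\mathcal A$ is the $\mathcal L_\alpha$-structure induced on the interpretation (also written $A$) of the predicate. In such a model, $\operatorname{acl}$ is computed in $\mathcal B$, and for $X,Y,Z\subseteq B$ we say that $X$ is *independent from $Y$ over $Z$* if every subset of $X$ that is $\operatorname{acl}$-independent over $Z$ is $\operatorname{acl}$-independent over $Y\cup Z$. An $\mathcal L^2$-theory $T$ is an *ML-theory* if: 1. $T$ extends $T^2$. 2. (Mordell–Lang condition) A *challenge* $(p(\vec x_\alpha),q(\vec x),\phi(\vec x,y),\psi(\vec x_\alpha,y))$ consists of a complete $\mathcal L_\alpha$-type $p$, a complete $\mathcal L_\beta$-type $q$, an $\mathcal L_\beta$-formula $\phi$ with $q(\vec x)\models\exists^{<\infty}y\,\phi(\vec x,y)$ and an $\mathcal L_\alpha$-formula $\psi$, where $\vec x_\alpha$ is a subtuple of $\vec x$. A *contender* is a model $(\mathcal B,\mathcal A)\models T$ with a tuple $\vec c$ in $B$ that realizes $q$, whose components lying in $A$ are exactly those of the subtuple $\vec c_\alpha$, such that $\vec c_\alpha$ realizes $p_A=\{\theta_A:\theta\in p\}$ and $\vec c$ is independent from $A$ over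 $\vec c_\alpha$. A *solution* is a contender together with some $a\in A$ such that $(\mathcal B,\mathcal A)\models\phi(\vec c,a)\wedge\psi_A(\vec c_\alpha,a)$. The condition: if a challenge has a solution in some model of $T$, then every contender to it, in any model of $T$, can be completed to a solution. 3. For every infinite cardinal $\kappa>|T^2|=\max(\aleph_0,|\mathcal L^2|)$, every $\kappa$-saturated $(\mathcal B,\mathcal A)\models T$, every $C\subseteq B$ with $|C|<\kappa$ and every non-algebraic complete unary $\mathcal L_\beta(C)$-type $q(x)$: (density) if $p(x)$ is a complete unary $\mathcal L_\alpha(A\cap C)$-type such that $q$ implies every quantifier-free $\mathcal L(A\cap C)$-formula in $p$, then some $a\in A$ realizes $p_A\cup q$; (codensity) some $b\in B\setminus\operatorname{acl}(A\cup C)$ realizes $q$. **Statement.** Let $T$ be an ML-theory, let $(\mathcal B,\mathcal A)$ be a model of $T$, and let $(\mathcal B',\mathcal A')\subseteq(\mathcal B,\mathcal A)$ be an $\mathcal L^2$-substructure that is also a model of $T$. Then $(\mathcal B',\mathcal A')\preccurlyeq(\mathcal B,\mathcal A)$ as $\mathcal L^2$-structures if and only if $\mathcal B'\preccurlyeq\mathcal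 B$ as $\mathcal L_\beta$-structures, $\mathcal A'\preccurlyeq\mathcal A$ as $\mathcal L_\alpha$-structures, and $B'$ is independent from $A$ over $A'$ (in $\mathcal B$). -/

import Mathlib

open FirstOrder FirstOrder.Language Cardinal

universe u v w x

namespace MLPair

/-! ### General model theory -/

section General

variable (L : FirstOrder.Language.{u, v}) {M : Type w} [L.Structure M]

/-- The model-theoretic algebraic closure of `X` in the `L`-structure `M`: the union of all finite
subsets of `M` that are `L`-definable with parameters from `X`. -/
def acl (X : Set M) : Set M :=
  {b | ∃ s : Set M, X.Definable₁ L s ∧ s.Finite ∧ b ∈ s}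

/-- `X` is `acl`-independent over `Z`. -/
def AclIndep (X Z : Set M) : Prop :=
  ∀ b ∈ X, b ∉ acl L (Z ∪ (X \ {b}))

/-- `X` and `Y` are independent over `Z`: every subset of `X` that is `acl`-independent over `Z`
is also `acl`-independent over `Y ∪ Z`. -/
def IndepOver (X Y Z : Set M) : Prop :=
  ∀ S ⊆ X, AclIndep L S Z → AclIndep L S (Y ∪ Z)

/-- `cl` is the closure operator of a pregeometry on `M`. -/
structure IsPregeometry {M : Type w} (cl : Set M → Set M) : Prop where
  subset_cl : ∀ X, X ⊆ cl X
  mono : ∀ X Y, X ⊆ Y → cl X ⊆ cl Y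
  idem : ∀ X, cl (cl X) = cl X
  finitary : ∀ X, ∀ b ∈ cl X, ∃ F ⊆ X, F.Finite ∧ b ∈ cl F
  exchange : ∀ X a b, a ∈ cl (X ∪ {b}) → a ∉ cl X → b ∈ cl (X ∪ {a})

/-- The theory `T` eliminates the quantifier `∃^∞`: for each formula `φ(x,y)` there is a bound `N`
such that in every model, each set `φ(c, ·)` is infinite or has at most `N` elements. -/
def EliminatesExistsInfinity {L : FirstOrder.Language.{u, v}} (T : L.Theory) : Prop :=
  ∀ (n : ℕ) (φ : L.Formula (Fin n ⊕ Unit)), ∃ N : ℕ,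
    ∀ (M : Type (max u v w)) [L.Structure M] [Nonempty M] [M ⊨ T] (c : Fin n → M),
      {b : M | φ.Realize (Sum.elim c fun _ => b)}.Infinite ∨
        {b : M | φ.Realize (Sum.elim c fun _ => b)}.ncard ≤ N

/-- The theory `T` is geometric. -/
structure IsGeometric {L : FirstOrder.Language.{u, v}} (T : L.Theory) : Prop where
  elim : EliminatesExistsInfinity.{u, v, w} T
  pregeometry : ∀ (M : Type (max u v w)) [L.Structure M] [Nonempty M] [M ⊨ T],
    IsPregeometry (acl L : Set M → Set M)

/-- The unary `L(C)`-formula `φ` (with free variables indexed by `C ⊕ Unit`, the variables in `C`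
standing for the parameters themselves) holds at the element `b`. -/
def HoldsAt {L : FirstOrder.Language.{u, v}} {M : Type w} [L.Structure M] {C : Set M}
    (φ : L.Formula (C ⊕ Unit)) (b : M) : Prop :=
  φ.Realize (Sum.elim (fun c : C => (c : M)) fun _ => b)

/-- A set of unary `L(C)`-formulas is finitely satisfiable in `M`. -/
def FinSat {L : FirstOrder.Language.{u, v}} {M : Type w} [L.Structure M] {C : Set M}
    (q : Set (L.Formula (C ⊕ Unit))) : Prop :=
  ∀ F ⊆ q, F.Finite → ∃ b : M, ∀ φ ∈ F, HoldsAt φ b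

/-- `q` is a (complete) unary `L(C)`-type, `C ⊆ M`. Finite satisfiability in `M` amounts to being
realized in some elementary extension of `M`. -/
def IsType {L : FirstOrder.Language.{u, v}} {M : Type w} [L.Structure M] {C : Set M}
    (q : Set (L.Formula (C ⊕ Unit))) : Prop :=
  FinSat q ∧ ∀ φ : L.Formula (C ⊕ Unit), φ ∈ q ∨ φ.not ∈ q

/-- The type `q` contains no formula with only finitely many solutions in `M`. -/
def NonAlgebraic {L : FirstOrder.Language.{u, v}} {M : Type w} [L.Structure M] {C : Set M}
    (q : Set (L.Formula (C ⊕ Unit))) : Prop :=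
  ∀ φ ∈ q, {b : M | HoldsAt φ b}.Infinite

/-- The `L`-structure `M` is `κ`-saturated: for each set `C` of fewer than `κ` parameters, every
finitely satisfiable set of unary `L(C)`-formulas is realized in `M`. -/
def IsSaturated (M : Type w) [L.Structure M] (κ : Cardinal.{w}) : Prop :=
  ∀ C : Set M, #C < κ → ∀ q : Set (L.Formula (C ⊕ Unit)), FinSat q →
    ∃ b : M, ∀ φ ∈ q, HoldsAt φ b

/-- The tuple `c` realizes the complete type `q`. -/
def Realizes {L : FirstOrder.Language.{u, v}} {T : L.Theory} {ι : Type x} (q : T.CompleteType ι)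
    {M : Type w} [L.Structure M] (c : ι → M) : Prop :=
  ∀ φ : L.Formula ι, Formula.equivSentence φ ∈ q → φ.Realize c

end General

/-! ### The language of pairs

`L` is the common part of the two languages `L_α` and `L_β`. Since every function symbol of `L_α`
is to be a symbol of `L_β`, we have `L_α = L ⊔ Eα` with `Eα` consisting of relation symbols only,
and `L_β = L ⊔ Eβ` with `Eβ` an arbitrary language. -/

/-- The one relation symbol `A`, of arity one. -/
inductive PredSymbol : ℕ → Type
  | A : PredSymbol 1

/-- The language whose only symbol is the unary predicate symbol `A`. -/
def predLang : FirstOrder.Language.{0, 0} := ⟨fun _ => Empty, PredSymbol⟩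

section Pairs

variable (L Eβ Eα : FirstOrder.Language.{u, v})

/-- The language `L_β`. -/
abbrev langB : FirstOrder.Language.{u, v} := L.sum Eβ

/-- The language `L_α`. -/
abbrev langA : FirstOrder.Language.{u, v} := L.sum Eα

/-- The language `L² = L_β ∪ L_α ∪ {A}`. -/
abbrev lang2 : FirstOrder.Language.{u, v} := (L.sum Eβ).sum (Eα.sum predLang)

/-- The inclusion of `L_β` in `L²`. -/
abbrev inclB : langB L Eβ →ᴸ lang2 L Eβ Eα := LHom.sumInl

/-- The inclusion of `L_α` in `L²`. -/
abbrev inclA : langA L Eα →ᴸ lang2 L Eβ Eα := LHom.sumMap LHom.sumInl LHom.sumInl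

/-- The predicate symbol `A` as a symbol of `L²`. -/
def predA : (lang2 L Eβ Eα).Relations 1 := Sum.inr (Sum.inr PredSymbol.A)

variable {L Eα}

/-- The relativization `θ_A` to the predicate `A` of the `L_α`-formula `θ`; the existential
quantifier `∃ = ¬∀¬` is then relativized as `∃ x, A(x) ∧ ⋯`. -/
def relativize {γ : Type x} : ∀ {n : ℕ},
    (langA L Eα).BoundedFormula γ n → (lang2 L Eβ Eα).BoundedFormula γ n
  | _, .falsum => .falsum
  | _, .equal t₁ t₂ => .equal ((inclA L Eβ Eα).onTerm t₁) ((inclA L Eβ Eα).onTerm t₂)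
  | _, .rel R ts => .rel ((inclA L Eβ Eα).onRelation R) fun i => (inclA L Eβ Eα).onTerm (ts i)
  | _, .imp θ₁ θ₂ => .imp (relativize θ₁) (relativize θ₂)
  | n, .all θ =>
      .all (.imp ((predA L Eβ Eα).boundedFormula₁ (Term.var (Sum.inr (Fin.last n))))
        (relativize θ))

/-- The relativization `θ_A` of an `L_α`-formula. -/
def relFormula {γ : Type x} (θ : (langA L Eα).Formula γ) : (lang2 L Eβ Eα).Formula γ :=
  relativize Eβ θ

variable (L Eα)

/-- The formula `A(x_1) ∧ ⋯ ∧ A(x_n)`. -/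
noncomputable def allInA (n : ℕ) : (lang2 L Eβ Eα).BoundedFormula Empty n :=
  BoundedFormula.iInf fun i : Fin n =>
    (predA L Eβ Eα).boundedFormula₁ (Term.var (Sum.inr i))

variable {L Eα}

/-- `∀ x_1 ⋯ x_n, A(x_1) ∧ ⋯ ∧ A(x_n) → A(f(x_1,…,x_n))` for a function symbol `f` of `L_α`. -/
noncomputable def closureAxiom {n : ℕ} (f : (langA L Eα).Functions n) :
    (lang2 L Eβ Eα).Sentence :=
  (BoundedFormula.imp (allInA L Eβ Eα n)
    ((predA L Eβ Eα).boundedFormula₁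
      (Term.func ((inclA L Eβ Eα).onFunction f) fun i => Term.var (Sum.inr i)))).alls

/-- `∀ x_1 ⋯ x_n, R(x_1,…,x_n) → A(x_1) ∧ ⋯ ∧ A(x_n)` for a relation symbol `R` of `L_α` that is
not in `L_β`. -/
noncomputable def supportAxiom {n : ℕ} (R : Eα.Relations n) : (lang2 L Eβ Eα).Sentence :=
  (BoundedFormula.imp
    (BoundedFormula.rel ((inclA L Eβ Eα).onRelation (Sum.inr R)) fun i => Term.var (Sum.inr i))
    (allInA L Eβ Eα n)).alls

variable {Eβ}

/-- The theory `T²` of pairs. -/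
def pairTheory (Tβ : (langB L Eβ).Theory) (Tα : (langA L Eα).Theory) :
    (lang2 L Eβ Eα).Theory :=
  (inclB L Eβ Eα).onTheory Tβ ∪ {σ | ∃ φ : (langA L Eα).Sentence, Tα ⊨ᵇ φ ∧ σ = relFormula Eβ φ} ∪
    {σ | ∃ (n : ℕ) (f : (langA L Eα).Functions n), σ = closureAxiom Eβ f} ∪
    {σ | ∃ (n : ℕ) (R : Eα.Relations n), σ = supportAxiom Eβ R}

/-- The `L²`-theory `T` extends `T²`. -/
def ExtendsPairTheory (Tβ : (langB L Eβ).Theory) (Tα : (langA L Eα).Theory)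
    (T : (lang2 L Eβ Eα).Theory) : Prop :=
  ∀ σ ∈ pairTheory Tβ Tα, T ⊨ᵇ σ

/-! An `L²`-structure on `M` is given by interpretations of the symbols in `L`, in `Eβ`, in `Eα`
and of `A`. The `L_β`-structure `𝓑` is then `M` with the interpretations of `L` and `Eβ`. -/

variable {M : Type w} [L.Structure M] [Eβ.Structure M] [Eα.Structure M] [predLang.Structure M]

variable (M) in
/-- The subset of `M` that interprets the predicate `A`. -/
def setA : Set M := {b | Structure.RelMap (L := predLang) PredSymbol.A ![b]}

theorem ExtendsPairTheory.model {Tβ : (langB L Eβ).Theory} {Tα : (langA L Eα).Theory}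
    {T : (lang2 L Eβ Eα).Theory} (h : ExtendsPairTheory Tβ Tα T) [Nonempty M] [M ⊨ T] :
    M ⊨ pairTheory Tβ Tα :=
  ⟨fun σ hσ => (h σ hσ).realize_sentence M⟩

theorem realize_predA {γ : Type x} {n : ℕ} (t : (lang2 L Eβ Eα).Term (γ ⊕ Fin n)) (a : γ → M)
    (b : Fin n → M) :
    ((predA L Eβ Eα).boundedFormula₁ t).Realize a b ↔ t.realize (Sum.elim a b) ∈ setA M := by
  rw [BoundedFormula.realize_rel₁]
  rfl

/-- The `L_α`-structure `𝓐` of a pair: the substructure with underlying set `A` of the reduct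
of `M` to `L_α`. -/
def structA {Tβ : (langB L Eβ).Theory} {Tα : (langA L Eα).Theory}
    (hM : M ⊨ pairTheory Tβ Tα) : (langA L Eα).Substructure M where
  carrier := setA M
  fun_mem := by
    intro n f a ha
    have h := hM.realize_of_mem (closureAxiom Eβ f) (Or.inl (Or.inr ⟨n, f, rfl⟩))
    rw [closureAxiom, Sentence.Realize, BoundedFormula.realize_alls] at h
    have h' := h a
    rw [BoundedFormula.realize_imp, allInA, BoundedFormula.realize_iInf, realize_predA] at h'
    have h'' := h' fun i => (realize_predA _ _ _).2 (ha i)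
    have e := LHom.map_onFunction (inclA L Eβ Eα) (M := M) f a
    rw [← e]
    exact h''

/-- A Mordell-Lang challenge `(p(x_α), q(x), φ(x,y), ψ(x_α,y))`. -/
structure Challenge (Tβ : (langB L Eβ).Theory) (Tα : (langA L Eα).Theory) where
  /-- The length of the tuple `x` of variables. -/
  n : ℕ
  /-- The positions of the variables in the subtuple `x_α`. -/
  pos : Set (Fin n)
  p : Tα.CompleteType pos
  q : Tβ.CompleteType (Fin n)
  φ : (langB L Eβ).Formula (Fin n ⊕ Unit)
  ψ : (langA L Eα).Formula (pos ⊕ Unit)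
  /-- `q(x) ⊨ ∃^{<∞} y, φ(x,y)`. -/
  finite : ∀ (N : Theory.ModelType.{u, v, max u v} Tβ) (c : Fin n → N), Realizes q c →
    {b : N | φ.Realize (Sum.elim c fun _ => b)}.Finite

variable {Tβ : (langB L Eβ).Theory} {Tα : (langA L Eα).Theory}

/-- `(M, c)` is a contender to the challenge: `c` realizes `q`, its subtuple `c_α` of the components
that belong to `A` realizes `p_A`, and `c` is independent from `A` over `c_α`. -/
structure Challenge.IsContender (X : Challenge Tβ Tα) (c : Fin X.n → M) : Prop where
  mem_iff : ∀ i, c i ∈ setA M ↔ i ∈ X.pos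
  realizes_q : Realizes X.q c
  realizes_p : ∀ θ : (langA L Eα).Formula X.pos, Formula.equivSentence θ ∈ X.p →
    (relFormula Eβ θ).Realize fun i : X.pos => c i
  indep : IndepOver (langB L Eβ) (Set.range c) (setA M) (c '' X.pos)

/-- `(M, c, a)` is a solution to the challenge. -/
structure Challenge.IsSolution (X : Challenge Tβ Tα) (c : Fin X.n → M) (a : M) : Prop where
  contender : X.IsContender c
  mem : a ∈ setA M
  realize_φ : X.φ.Realize (Sum.elim c fun _ => a)
  realize_ψ : (relFormula Eβ X.ψ).Realize (Sum.elim (fun i : X.pos => c i) fun _ => a)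

variable (Tβ Tα) in
/-- The Mordell-Lang condition: if a challenge has a solution in some model of `T`, then each of its
contenders in each model of `T` extends to a solution. -/
def MordellLangCondition (T : (lang2 L Eβ Eα).Theory) : Prop :=
  ∀ X : Challenge Tβ Tα,
    (∃ (N : Type (max u v w)) (_ : L.Structure N) (_ : Eβ.Structure N) (_ : Eα.Structure N)
      (_ : predLang.Structure N) (_ : Nonempty N) (_ : N ⊨ T) (c : Fin X.n → N) (a : N),
      X.IsSolution c a) →
    ∀ (M : Type (max u v w)) [L.Structure M] [Eβ.Structure M] [Eα.Structure M]
      [predLang.Structure M] [Nonempty M] [M ⊨ T] (c : Fin X.n → M),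
      X.IsContender c → ∃ a : M, X.IsSolution c a

/-- The density condition for the model `M`, the parameter set `C` and the `L_β(C)`-type `q`:
whenever `p` is a unary `L_α(A ∩ C)`-type and `q` implies all quantifier-free `L(A ∩ C)`-formulas
in `p`, some element of `A` realizes `p_A ∪ q`. -/
def Density (hM : M ⊨ pairTheory Tβ Tα) (C : Set M)
    (q : Set ((langB L Eβ).Formula (C ⊕ Unit))) : Prop :=
  ∀ p : Set ((langA L Eα).Formula ({c : structA hM | (c : M) ∈ C} ⊕ Unit)), IsType p →
    (∀ χ : L.Formula ({c : structA hM | (c : M) ∈ C} ⊕ Unit), BoundedFormula.IsQF χ →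
      (LHom.sumInl : L →ᴸ langA L Eα).onFormula χ ∈ p →
      (LHom.sumInl : L →ᴸ langB L Eβ).onFormula
        (χ.relabel (Sum.map (fun c => (⟨c.1.1, c.2⟩ : C)) id)) ∈ q) →
    ∃ a ∈ setA M, (∀ φ ∈ q, HoldsAt φ a) ∧
      ∀ ψ ∈ p, (relFormula Eβ ψ).Realize (Sum.elim (fun c => (c.1.1 : M)) fun _ => a)

/-- The codensity condition for `M`, `C` and the `L_β(C)`-type `q`: some realization of `q` is not
in `acl(A ∪ C)`. -/
def Codensity (C : Set M) (q : Set ((langB L Eβ).Formula (C ⊕ Unit))) : Prop :=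
  ∃ b : M, b ∉ acl (langB L Eβ) (setA M ∪ C) ∧ ∀ φ ∈ q, HoldsAt φ b

variable (Tβ Tα) in
/-- `T` is a Mordell-Lang theory of pairs (ML-theory), with respect to `Tβ` and `Tα`. -/
structure IsMLTheory (T : (lang2 L Eβ Eα).Theory) : Prop where
  extends_pairTheory : ExtendsPairTheory Tβ Tα T
  mordellLang : MordellLangCondition.{u, v, w} Tβ Tα T
  density : ∀ (M : Type (max u v w)) [L.Structure M] [Eβ.Structure M] [Eα.Structure M]
    [predLang.Structure M] [Nonempty M] [M ⊨ T] (κ : Cardinal.{max u v w}),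
    Cardinal.lift.{w} (max ℵ₀ (lang2 L Eβ Eα).card) < κ → IsSaturated (lang2 L Eβ Eα) M κ →
    ∀ C : Set M, #C < κ → ∀ q : Set ((langB L Eβ).Formula (C ⊕ Unit)),
      IsType q → NonAlgebraic q → Density (extends_pairTheory.model (M := M)) C q
  codensity : ∀ (M : Type (max u v w)) [L.Structure M] [Eβ.Structure M] [Eα.Structure M]
    [predLang.Structure M] [Nonempty M] [M ⊨ T] (κ : Cardinal.{max u v w}),
    Cardinal.lift.{w} (max ℵ₀ (lang2 L Eβ Eα).card) < κ → IsSaturated (lang2 L Eβ Eα) M κ →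
    ∀ C : Set M, #C < κ → ∀ q : Set ((langB L Eβ).Formula (C ⊕ Unit)),
      IsType q → NonAlgebraic q → Codensity C q

variable (S : (lang2 L Eβ Eα).Substructure M)

/-- For a substructure `S = (𝓑',𝓐')` of the pair `M = (𝓑,𝓐)`, the `L_β`-structure `𝓑'` as a
substructure of `𝓑`. -/
def subB : (langB L Eβ).Substructure M :=
  (inclB L Eβ Eα).substructureReduct S

/-- For a substructure `S = (𝓑',𝓐')` of the pair `M = (𝓑,𝓐)`, the `L_α`-structure `𝓐'`, with
underlying set `A' = A ∩ B'`, as a substructure of `𝓐`. -/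
def subA (hM : M ⊨ pairTheory Tβ Tα) : (langA L Eα).Substructure (structA hM) :=
  ((inclA L Eβ Eα).substructureReduct S).comap (structA hM).subtype.toHom

end Pairs

end MLPair

-- If the inclusion is elementary, restriction to $\mathcal L_\beta$-formulas and to relativized
-- formulas $\theta_A$ gives the two elementary inclusions. Independence follows because
-- algebraicity of $b$ over $A\cup X$ is witnessed by an $\mathcal L^2$-formula over finitely many
-- elements of $X$: some elements of $A$ make $\phi(\dots,y)$ true at $b$ and give it fewer than $k$
-- solutions. An elementary map reflects such a formula (`mem_acl_setA_of_elementaryEmbedding`).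
--
-- The converse is a back-and-forth argument. Two finite tuples correspond (`Good`) if they have the
-- same $\mathcal L_\beta$-type, their parts in $A$ have the same $\mathcal L_\alpha$-type, and the
-- same index set selects in both a basis over the part in $A$ that stays independent over all of
-- $A$. Between sufficiently saturated models of $T$ a correspondence extends to any further element
-- $b$ (`Good.hasExtension_singleton`): - if $b\in A$ is algebraic over the tuple, by the
-- Mordell–Lang condition and compactness; - if $b\in A$ is not algebraic over it, by density; - if
-- $b\notin A$ is algebraic over $A$ and the tuple, by adding finitely many elements of $A$ until
-- $b$ is algebraic over the tuple and cannot be matched with an element of $A$; - otherwise by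
-- codensity.
--
-- Hence corresponding tuples have the same $\mathcal L^2$-type (`Good.sameType`); saturation is
-- obtained by passing to elementary extensions. Under the three conditions of the theorem every
-- finite tuple of the smaller pair extends to one that corresponds to its own image
-- (`exists_good_extension`), so the inclusion is elementary.
--
-- The saturated extension is built in one step. Its elements are named in advance by well-founded
-- terms, one for each type over earlier names, and Zorn's lemma yields an ultrafilter on the
-- assignments of values in $M$ to names under which every name realizes its type whenever that type
-- is finitely satisfiable.

universe y

namespace MLPair

/-! ### Saturated elementary extensions -/

section Saturation

/-- Names for the elements of a saturated extension of `M`: each element of `M` has a name, and each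
`I`-tuple of names with a set of formulas has a name for a realization of these formulas. -/
inductive SatName (M : Type w) (I : Type w) (Q : Type w) : Type w
  | base : M → SatName M I Q
  | wit : (I → SatName M I Q) → Q → SatName M I Q

variable {L : FirstOrder.Language.{u, v}} {M : Type (max u v w)} [L.Structure M]
  {I : Type (max u v w)}

variable (L M I) in
/-- The names for formulas of `L`. -/
abbrev LName : Type (max u v w) := SatName M I (Set (L.Formula (I ⊕ Unit)))

/-- A set of assignments is determined by the values at the names in `D`. -/
def DeterminedBy {α β : Type*} (D : Set α) (s : Set (α → β)) : Prop :=
  ∀ a b : α → β, (∀ i ∈ D, a i = b i) → a ∈ s → b ∈ s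

theorem DeterminedBy.mono {α β : Type*} {D D' : Set α} (h : D ⊆ D') {s : Set (α → β)}
    (hs : DeterminedBy D s) : DeterminedBy D' s :=
  fun a b hab ha => hs a b (fun i hi => hab i (h hi)) ha

theorem DeterminedBy.inter {α β : Type*} {D : Set α} {s t : Set (α → β)}
    (hs : DeterminedBy D s) (ht : DeterminedBy D t) : DeterminedBy D (s ∩ t) :=
  fun a b hab ha => ⟨hs a b hab ha.1, ht a b hab ha.2⟩

theorem DeterminedBy.compl {α β : Type*} {D : Set α} {s : Set (α → β)}
    (hs : DeterminedBy D s) : DeterminedBy D sᶜ :=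
  fun a b hab ha hb => ha (hs b a (fun i hi => (hab i hi).symm) hb)

/-- The assignments that satisfy `∃ y, ⋀ G(f, y)`. -/
def exSet (f : I → LName L M I) (G : Set (L.Formula (I ⊕ Unit))) : Set (LName L M I → M) :=
  {a | ∃ y : M, ∀ φ ∈ G, φ.Realize (Sum.elim (a ∘ f) fun _ => y)}

/-- The assignments that satisfy `φ(f, c)`. -/
def witSet (f : I → LName L M I) (c : LName L M I) (φ : L.Formula (I ⊕ Unit)) :
    Set (LName L M I → M) :=
  {a | φ.Realize (Sum.elim (a ∘ f) fun _ => a c)}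

theorem exSet_determinedBy {D : Set (LName L M I)} {f : I → LName L M I} (hf : ∀ i, f i ∈ D)
    (G : Set (L.Formula (I ⊕ Unit))) : DeterminedBy D (exSet f G) := by
  rintro a b hab ⟨y, hy⟩
  have : a ∘ f = b ∘ f := funext fun i => hab _ (hf i)
  exact ⟨y, by rwa [← this]⟩

theorem witSet_determinedBy {D : Set (LName L M I)} {f : I → LName L M I} (hf : ∀ i, f i ∈ D)
    {c : LName L M I} (hc : c ∈ D) (φ : L.Formula (I ⊕ Unit)) :
    DeterminedBy D (witSet f c φ) := by
  intro a b hab ha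
  have : a ∘ f = b ∘ f := funext fun i => hab _ (hf i)
  have h2 := hab _ hc
  simpa only [witSet, Set.mem_ofPred_eq, this, h2] using ha

variable (L M I) in
/-- A subterm-closed set of names together with an ultrafilter of assignments for which these names
are interpreted as intended. -/
structure PartialSat where
  /-- The set of names. -/
  dom : Set (LName L M I)
  /-- The ultrafilter of assignments. -/
  uf : Ultrafilter (LName L M I → M)
  base_mem : ∀ m, SatName.base m ∈ dom
  base_eq : ∀ m, {a : LName L M I → M | a (SatName.base m) = m} ∈ uf
  closed : ∀ f q, SatName.wit f q ∈ dom → ∀ i, f i ∈ dom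
  wit : ∀ f q, SatName.wit f q ∈ dom → (∀ G ⊆ q, G.Finite → exSet f G ∈ uf) →
    ∀ φ ∈ q, witSet f (SatName.wit f q) φ ∈ uf

/-- Only the sets determined by the smaller domain must keep their status. The ultrafilter may
change elsewhere, which leaves the freedom to choose the value of a new name. -/
instance : Preorder (PartialSat L M I) where
  le P Q := P.dom ⊆ Q.dom ∧ ∀ s, DeterminedBy P.dom s → s ∈ P.uf → s ∈ Q.uf
  le_refl P := ⟨subset_rfl, fun _ _ h => h⟩
  le_trans P Q R h₁ h₂ := ⟨h₁.1.trans h₂.1, fun s hs h => h₂.2 s (hs.mono h₁.1) (h₁.2 s hs h)⟩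

/-- Both `exSet` and its complement are determined by `P.dom`, so `U` and `P.uf` agree on finite
satisfiability, and the witnessing sets then pass from `P.uf` to `U`. -/
theorem PartialSat.wit_of_le {P : PartialSat L M I} {U : Ultrafilter (LName L M I → M)}
    (hU : ∀ s, DeterminedBy P.dom s → s ∈ P.uf → s ∈ U) {f : I → LName L M I}
    {q : Set (L.Formula (I ⊕ Unit))} (hd : SatName.wit f q ∈ P.dom)
    (h : ∀ G ⊆ q, G.Finite → exSet f G ∈ U) :
    ∀ φ ∈ q, witSet f (SatName.wit f q) φ ∈ U := by
  have hf := P.closed f q hd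
  refine fun φ hφ => hU _ (witSet_determinedBy hf hd φ) (P.wit f q hd (fun G hG hfin => ?_) φ hφ)
  by_contra hP
  exact Ultrafilter.compl_mem_iff_notMem.1
    (hU _ (exSet_determinedBy hf G).compl (Ultrafilter.compl_mem_iff_notMem.2 hP)) (h G hG hfin)

/-- A family of sets with nonempty finite intersections is contained in an ultrafilter. -/
theorem exists_ultrafilter_of_inter_nonempty {α : Type*} (B : Set (Set α))
    (hB : ∀ F ⊆ B, F.Finite → (⋂₀ F).Nonempty) : ∃ U : Ultrafilter α, ∀ s ∈ B, s ∈ U := by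
  have : (Filter.generate B).NeBot :=
    Filter.generate_neBot_iff.2 fun F hF hfin => hB F hF hfin
  obtain ⟨U, hU⟩ := Ultrafilter.exists_le (Filter.generate B)
  exact ⟨U, fun s hs => hU (Filter.mem_generate_of_mem hs)⟩

theorem PartialSat.exists_bot [Nonempty M] : Nonempty (PartialSat L M I) := by
  classical
  let a₀ : LName L M I → M := fun c => match c with
    | .base m => m
    | .wit _ _ => Classical.arbitrary M
  exact ⟨{ dom := Set.range SatName.base
           uf := pure a₀
           base_mem := fun m => ⟨m, rfl⟩
           base_eq := fun m => rfl
           closed := by rintro f q ⟨m, hm⟩; cases hm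
           wit := by rintro f q ⟨m, hm⟩; cases hm }⟩

/-- Finitely many sets prescribed by members of the chain are all prescribed by a single member, so
they have a common point and some ultrafilter contains all prescribed sets. -/
theorem PartialSat.bddAbove_chain {c : Set (PartialSat L M I)} (hc : IsChain (· ≤ ·) c)
    (hne : c.Nonempty) : BddAbove c := by
  obtain ⟨P₀, hP₀⟩ := hne
  have key : ∀ F : Set (Set (LName L M I → M)), F.Finite →
      F ⊆ {s | ∃ P ∈ c, DeterminedBy P.dom s ∧ s ∈ P.uf} →
      ∃ P ∈ c, DeterminedBy P.dom (⋂₀ F) ∧ ⋂₀ F ∈ P.uf := by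
    intro F hF
    induction F, hF using Set.Finite.induction_on with
    | empty =>
      intro _
      exact ⟨P₀, hP₀, fun _ _ _ _ => by simp, by
        rw [Set.sInter_empty]; exact Filter.univ_mem⟩
    | @insert s F _ _ ih =>
      intro h
      obtain ⟨P, hP, hPd, hPm⟩ := ih ((Set.subset_insert _ _).trans h)
      obtain ⟨Q, hQ, hQd, hQm⟩ := h (Set.mem_insert _ _)
      rw [Set.sInter_insert]
      rcases hc.total hP hQ with hle | hle
      · exact ⟨Q, hQ, hQd.inter (hPd.mono hle.1), Filter.inter_mem hQm (hle.2 _ hPd hPm)⟩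
      · exact ⟨P, hP, (hQd.mono hle.1).inter hPd, Filter.inter_mem (hle.2 _ hQd hQm) hPm⟩
  obtain ⟨U, hU⟩ := exists_ultrafilter_of_inter_nonempty
    {s : Set (LName L M I → M) | ∃ P ∈ c, DeterminedBy P.dom s ∧ s ∈ P.uf} fun F hF hfin => by
      obtain ⟨P, -, -, h⟩ := key F hfin hF
      exact Filter.nonempty_of_mem h
  refine ⟨{ dom := ⋃ P ∈ c, P.dom
            uf := U
            base_mem := fun m => Set.mem_biUnion hP₀ (P₀.base_mem m)
            base_eq := fun m => hU _ ⟨P₀, hP₀, ?_, P₀.base_eq m⟩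
            closed := ?_
            wit := ?_ }, fun P hP => ⟨Set.subset_biUnion_of_mem hP, fun s hs h => hU s ⟨P, hP, hs, h⟩⟩⟩
  · intro a b hab ha
    simpa [hab _ (P₀.base_mem m)] using ha
  · intro f q h i
    obtain ⟨P, hP, hd⟩ := Set.mem_iUnion₂.1 h
    exact Set.mem_biUnion hP (P.closed f q hd i)
  · intro f q h hG
    obtain ⟨P, hP, hd⟩ := Set.mem_iUnion₂.1 h
    exact P.wit_of_le (fun s hs hm => hU s ⟨P, hP, hs, hm⟩) hd hG

/-- The new name lies outside `P.dom`, so its value can be changed without leaving a set determined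
by `P.dom`. Finite satisfiability of `q` then gives the finite intersection property for the old
prescribed sets together with the new `witSet`s. If `q` is not finitely satisfiable, nothing is
required of the new name. -/
theorem PartialSat.exists_insert (P : PartialSat L M I) (f : I → LName L M I)
    (q : Set (L.Formula (I ⊕ Unit))) (hf : ∀ i, f i ∈ P.dom) (hn : SatName.wit f q ∉ P.dom) :
    ∃ Q : PartialSat L M I, P ≤ Q ∧ SatName.wit f q ∈ Q.dom := by
  classical
  set c := SatName.wit f q with hcdef
  obtain ⟨U, hU, hUq⟩ : ∃ U : Ultrafilter (LName L M I → M),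
      (∀ s, DeterminedBy P.dom s → s ∈ P.uf → s ∈ U) ∧
      ((∀ G ⊆ q, G.Finite → exSet f G ∈ P.uf) → ∀ φ ∈ q, witSet f c φ ∈ U) := by
    by_cases hq : ∀ G ⊆ q, G.Finite → exSet f G ∈ P.uf
    · obtain ⟨U, hU⟩ := exists_ultrafilter_of_inter_nonempty
        ({s : Set (LName L M I → M) | DeterminedBy P.dom s ∧ s ∈ P.uf} ∪ witSet f c '' q) (by
          intro F hF hfin
          have hsplit : ∃ s, DeterminedBy P.dom s ∧ s ∈ P.uf ∧ ∃ G ⊆ q, G.Finite ∧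
              ∀ a ∈ s, (∀ φ ∈ G, a ∈ witSet f c φ) → a ∈ ⋂₀ F := by
            induction F, hfin using Set.Finite.induction_on with
            | empty =>
              exact ⟨Set.univ, fun _ _ _ _ => trivial, Filter.univ_mem, ∅, Set.empty_subset _,
                Set.finite_empty, by simp⟩
            | @insert t F _ _ ih =>
              obtain ⟨s, hs, hm, G, hG, hGf, h⟩ := ih ((Set.subset_insert _ _).trans hF)
              rcases hF (Set.mem_insert _ _) with ht | ⟨φ, hφ, rfl⟩
              · refine ⟨t ∩ s, ht.1.inter hs, Filter.inter_mem ht.2 hm, G, hG, hGf, ?_⟩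
                intro a ha haG
                rw [Set.sInter_insert]
                exact ⟨ha.1, h a ha.2 haG⟩
              · refine ⟨s, hs, hm, insert φ G, Set.insert_subset hφ hG, hGf.insert φ, ?_⟩
                intro a ha haG
                rw [Set.sInter_insert]
                exact ⟨haG φ (Set.mem_insert _ _),
                  h a ha fun ψ hψ => haG ψ (Set.mem_insert_of_mem _ hψ)⟩
          obtain ⟨s, hs, hm, G, hG, hGf, h⟩ := hsplit
          obtain ⟨a, has, y, hy⟩ := Filter.nonempty_of_mem (Filter.inter_mem hm (hq G hG hGf))
          have hag : ∀ i ∈ P.dom, a i = Function.update a c y i := fun i hi =>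
            (Function.update_of_ne (fun e : i = c => hn (e ▸ hi)) y a).symm
          refine ⟨Function.update a c y, h _ (hs _ _ hag has) fun φ hφ => ?_⟩
          have e : Function.update a c y ∘ f = a ∘ f := funext fun i => (hag _ (hf i)).symm
          simp only [witSet, Set.mem_ofPred_eq, e, Function.update_self]
          exact hy φ hφ)
      exact ⟨U, fun s hs hm => hU s (Or.inl ⟨hs, hm⟩), fun _ φ hφ => hU _ (Or.inr ⟨φ, hφ, rfl⟩)⟩
    · exact ⟨P.uf, fun s _ h => h, fun h => absurd h hq⟩
  refine ⟨{ dom := insert c P.dom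
            uf := U
            base_mem := fun m => Set.mem_insert_of_mem _ (P.base_mem m)
            base_eq := fun m => hU _ ?_ (P.base_eq m)
            closed := ?_
            wit := ?_ }, ⟨Set.subset_insert _ _, hU⟩, Set.mem_insert _ _⟩
  · intro a b hab ha
    simpa [hab _ (P.base_mem m)] using ha
  · rintro g r (h | h) i
    · obtain ⟨rfl, rfl⟩ := SatName.wit.inj h
      exact Set.mem_insert_of_mem _ (hf i)
    · exact Set.mem_insert_of_mem _ (P.closed g r h i)
  · rintro g r (h | h) hG
    · obtain ⟨rfl, rfl⟩ := SatName.wit.inj h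
      refine hUq fun G hGq hGf => ?_
      by_contra hP
      exact Ultrafilter.compl_mem_iff_notMem.1
        (hU _ (exSet_determinedBy hf G).compl (Ultrafilter.compl_mem_iff_notMem.2 hP))
        (hG G hGq hGf)
    · exact P.wit_of_le hU h hG

-- In a maximal element no name is missing: by induction on names its arguments are present, so it
-- could be inserted.
variable (L M I) in
theorem PartialSat.exists_total [Nonempty M] :
    ∃ P : PartialSat L M I, ∀ c, c ∈ P.dom := by
  have := PartialSat.exists_bot (L := L) (M := M) (I := I)
  obtain ⟨P, hP⟩ := zorn_le_nonempty (α := PartialSat L M I)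
    fun c hc hne => PartialSat.bddAbove_chain hc hne
  refine ⟨P, fun c => ?_⟩
  induction c with
  | base m => exact P.base_mem m
  | wit f q ih =>
    by_contra hn
    obtain ⟨Q, hPQ, hQ⟩ := P.exists_insert f q ih hn
    exact hn ((hP hPQ).1 hQ)

/-- A saturated elementary extension exists. -/
theorem exists_isSaturated_extension (L : FirstOrder.Language.{u, v}) (M : Type (max u v w))
    [L.Structure M] [Nonempty M] (κ : Cardinal.{max u v w}) (hκ : ℵ₀ ≤ κ) :
    ∃ (N : Type (max u v w)) (_ : L.Structure N), Nonempty (M ↪ₑ[L] N) ∧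
      IsSaturated (L := L) N (Order.succ κ) := by
  classical
  -- The type `I` of cardinality `κ` serves as index set for all parameter tuples.
  induction κ using Cardinal.inductionOn with | _ I => ?_
  obtain ⟨P, hP⟩ := PartialSat.exists_total L M I
  let N₀ := (P.uf : Filter (LName L M I → M)).Product fun _ => M
  -- A name is interpreted by evaluation at it, as an element of the ultrapower. The extension
  -- sought is the set of these values, since only parameters that have names are covered by the
  -- witnesses.
  let val : LName L M I → N₀ := fun c => ((fun a => a c : (LName L M I → M) → M) : N₀)
  have I_inf : Infinite I := Cardinal.infinite_iff.2 hκ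
  have realI : ∀ (f : I → LName L M I) (q : Set (L.Formula (I ⊕ Unit))),
      (∀ G ⊆ q, G.Finite → ∃ y : N₀, ∀ φ ∈ G, φ.Realize (Sum.elim (val ∘ f) fun _ => y)) →
      ∃ c, ∀ φ ∈ q, φ.Realize (Sum.elim (val ∘ f) fun _ => val c) := by
    intro f q hq
    have los : ∀ (φ : L.Formula (I ⊕ Unit)) (g : (LName L M I → M) → M),
        φ.Realize (Sum.elim (val ∘ f) fun _ => (g : N₀)) ↔
          ∀ᶠ a in (P.uf : Filter (LName L M I → M)),
            φ.Realize (Sum.elim (a ∘ f) fun _ => g a) := by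
      intro φ g
      have h := Ultraproduct.realize_formula_cast (u := P.uf) (M := fun _ => M) φ
        (Sum.elim (fun i a => a (f i)) fun _ => g)
      have e₁ : (fun i => ((Sum.elim (fun i a => a (f i)) (fun _ : Unit => g) i :
          (LName L M I → M) → M) : N₀)) = Sum.elim (val ∘ f) fun _ => (g : N₀) := by
        funext i; cases i <;> rfl
      have e₂ : ∀ a : LName L M I → M,
          (fun i => Sum.elim (fun i (a : LName L M I → M) => a (f i)) (fun _ : Unit => g) i a) =
            Sum.elim (a ∘ f) fun _ => g a := by
        intro a; funext i; cases i <;> rfl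
      rw [← e₁]
      refine h.trans ?_
      simp only [e₂]
    refine ⟨SatName.wit f q, fun φ hφ => (los φ _).2 ?_⟩
    refine P.wit f q (hP _) (fun G hG hGf => ?_) φ hφ
    obtain ⟨y, hy⟩ := hq G hG hGf
    induction y using Quotient.inductionOn with | _ g => ?_
    have h := (Filter.eventually_all_finite hGf).2 fun φ hφ => (los φ g).1 (hy φ hφ)
    exact Filter.mem_of_superset h fun a ha => ⟨g a, ha⟩
  have real : ∀ {K : Type (max u v w)} (e : K ↪ I) (cs : K → LName L M I)
      (q : Set (L.Formula (K ⊕ Unit))),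
      (∀ G ⊆ q, G.Finite → ∃ y : N₀, ∀ φ ∈ G, φ.Realize (Sum.elim (val ∘ cs) fun _ => y)) →
      ∃ c, ∀ φ ∈ q, φ.Realize (Sum.elim (val ∘ cs) fun _ => val c) := by
    intro K e cs q hq
    -- Indices outside the image of `K` receive an arbitrary name; no relabelled formula mentions
    -- them.
    let f : I → LName L M I := Function.extend e cs fun _ => SatName.base (Classical.arbitrary M)
    have hf : ∀ k, f (e k) = cs k := fun k => e.injective.extend_apply _ _ _
    have hr : ∀ (φ : L.Formula (K ⊕ Unit)) (y : N₀),
        (φ.relabel (Sum.map e id)).Realize (Sum.elim (val ∘ f) fun _ => y) ↔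
          φ.Realize (Sum.elim (val ∘ cs) fun _ => y) := by
      intro φ y
      rw [Formula.realize_relabel]
      have : (Sum.elim (val ∘ f) fun _ : Unit => y) ∘ Sum.map e id =
          Sum.elim (val ∘ cs) fun _ => y := by
        funext i
        cases i with
        | inl k => simp [hf]
        | inr _ => rfl
      rw [this]
    obtain ⟨c, hc⟩ := realI f ((fun φ => φ.relabel (Sum.map e id)) '' q) (by
      intro G hG hGf
      obtain ⟨G', hG', hGf', rfl⟩ :=
        Set.exists_subset_image_finite_and.1 ⟨G, hG, hGf, rfl⟩
      obtain ⟨y, hy⟩ := hq G' hG' hGf'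
      refine ⟨y, ?_⟩
      rintro _ ⟨φ, hφ, rfl⟩
      exact (hr φ y).2 (hy φ hφ))
    exact ⟨c, fun φ hφ => (hr φ _).1 (hc _ ⟨φ, hφ, rfl⟩)⟩
  have realFin : ∀ {n : ℕ} (cs : Fin n → LName L M I) (φ : L.Formula (Fin n ⊕ Unit)) (y : N₀),
      φ.Realize (Sum.elim (val ∘ cs) fun _ => y) →
      ∃ c, φ.Realize (Sum.elim (val ∘ cs) fun _ => val c) := by
    intro n cs φ y hy
    have e : ULift.{max u v w} (Fin n) ↪ I :=
      (Equiv.ulift.toEmbedding.trans Fin.valEmbedding).trans (Infinite.natEmbedding I)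
    have hr : ∀ y : N₀, (φ.relabel (Sum.map ULift.up.{max u v w} id)).Realize
        (Sum.elim (val ∘ (cs ∘ ULift.down.{max u v w})) fun _ => y) ↔
        φ.Realize (Sum.elim (val ∘ cs) fun _ => y) := by
      intro y
      rw [Formula.realize_relabel, Sum.elim_comp_map]
      rfl
    obtain ⟨c, hc⟩ := real e (cs ∘ ULift.down) {φ.relabel (Sum.map ULift.up id)} (by
      intro G hG _
      refine ⟨y, fun ψ hψ => ?_⟩
      obtain rfl := hG hψ
      exact (hr y).2 hy)
    exact ⟨c, (hr _).1 (hc _ rfl)⟩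
  -- Closure under a function symbol `g` comes from a named solution of `y = g(x)`. The
  -- Tarski–Vaught test below uses a named solution of an arbitrary formula in the same way.
  let S : L.Substructure N₀ :=
    { carrier := Set.range val
      fun_mem := by
        intro n g xs hxs
        choose cs hcs using hxs
        obtain ⟨c, hc⟩ := realFin cs
          (Term.equal (Term.var (Sum.inr ())) (Term.func g fun i => Term.var (Sum.inl i)))
          (Structure.funMap g xs) (by
            rw [Formula.realize_equal]
            simp [hcs])
        rw [Formula.realize_equal] at hc
        refine ⟨c, ?_⟩
        simpa [hcs] using hc }
  have hS : S.IsElementary := by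
    refine S.isElementary_of_exists fun n φ x a h => ?_
    choose cs hcs using fun i => (x i).2
    let ρ : Empty ⊕ Fin (n + 1) → Fin n ⊕ Unit :=
      Sum.elim Empty.elim (Fin.lastCases (Sum.inr ()) Sum.inl)
    have hr : ∀ y : N₀, (φ.toFormula.relabel ρ).Realize (Sum.elim (val ∘ cs) fun _ => y) ↔
        φ.Realize default (Fin.snoc (fun i => (x i : N₀)) y : _ → N₀) := by
      intro y
      rw [Formula.realize_relabel, BoundedFormula.realize_toFormula]
      have : ((Sum.elim (val ∘ cs) fun _ : Unit => y) ∘ ρ) ∘ Sum.inr =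
          (Fin.snoc (fun i => (x i : N₀)) y : _ → N₀) := by
        funext i
        refine Fin.lastCases ?_ (fun j => ?_) i
        · simp [ρ]
        · simp [ρ, hcs]
      rw [this]
      exact iff_of_eq (congrArg (fun v => φ.Realize v _) (Subsingleton.elim _ _))
    obtain ⟨c, hc⟩ := realFin cs (φ.toFormula.relabel ρ) a ((hr a).2 h)
    exact ⟨⟨val c, c, rfl⟩, (hr _).1 hc⟩
  let S' : L.ElementarySubstructure N₀ := ⟨S, hS⟩
  have diag : ∀ m : M, val (SatName.base m) = ((fun _ => m : (LName L M I → M) → M) : N₀) :=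
    fun m => Quotient.sound (P.base_eq m)
  refine ⟨S', inferInstance, ⟨⟨fun m => ⟨val (SatName.base m), _, rfl⟩, ?_⟩⟩, ?_⟩
  · intro n φ x
    rw [← S'.subtype.map_formula]
    have h := Ultraproduct.realize_formula_cast (u := P.uf) (M := fun _ => M) φ
      (fun i _ => x i)
    rw [Filter.eventually_const] at h
    refine Iff.trans ?_ h
    have : (S'.subtype ∘ (fun m => ⟨val (SatName.base m), _, rfl⟩ : M → S') ∘ x) =
        fun i => ((fun _ => x i : (LName L M I → M) → M) : N₀) := funext fun i => diag _
    rw [← this]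
    rfl
  · intro C hC q hq
    -- Fewer than `succ κ` parameters means at most `κ`, so they embed in `I`.
    rw [Order.lt_succ_iff, Cardinal.le_def] at hC
    obtain ⟨e⟩ := hC
    choose cs hcs using fun c : C => c.1.2
    have hr : ∀ (φ : L.Formula (C ⊕ Unit)) (y : S'), HoldsAt φ y ↔
        φ.Realize (Sum.elim (val ∘ cs) fun _ => (y : N₀)) := by
      intro φ y
      rw [HoldsAt, ← S'.subtype.map_formula]
      have : S'.subtype ∘ (Sum.elim (fun c : C => (c : S')) fun _ : Unit => y) =
          Sum.elim (val ∘ cs) fun _ => (y : N₀) := by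
        funext i
        cases i with
        | inl c => exact (hcs c).symm
        | inr _ => rfl
      rw [this]
    obtain ⟨c, hc⟩ := real e cs q (by
      intro G hG hGf
      obtain ⟨y, hy⟩ := hq G hG hGf
      exact ⟨y, fun φ hφ => (hr φ y).1 (hy φ hφ)⟩)
    exact ⟨⟨val c, c, rfl⟩, fun φ hφ => (hr φ _).2 (hc φ hφ)⟩

end Saturation

/-! ### Pregeometries -/

section Pregeometry

variable {L : FirstOrder.Language.{u, v}} {M : Type w} [L.Structure M] {S X Y Z A E : Set M}

theorem IsPregeometry.cl_subset {cl : Set M → Set M} (h : IsPregeometry cl) (hXY : X ⊆ cl Y) :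
    cl X ⊆ cl Y :=
  (h.mono _ _ hXY).trans (h.idem Y).subset

theorem AclIndep.subset (hS : AclIndep L S Z) (h : IsPregeometry (acl L : Set M → Set M))
    (hX : X ⊆ S) : AclIndep L X Z :=
  fun b hb hcl => hS b (hX hb)
    (h.mono _ _ (Set.union_subset_union_right _ (Set.sdiff_subset_sdiff_left hX)) hcl)

/-- If an element of `S` became algebraic over the others with the help of `b`, exchange would make
`b` algebraic over `Z ∪ S`. -/
theorem AclIndep.insert (hS : AclIndep L S Z) (h : IsPregeometry (acl L : Set M → Set M)) {b : M}
    (hb : b ∉ acl L (Z ∪ S)) : AclIndep L (insert b S) Z := by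
  rintro x hx hcl
  rcases eq_or_ne x b with rfl | hne
  · exact hb (h.mono _ _ (Set.union_subset_union_right _ (by
      rintro y ⟨hy | hy, hyx⟩
      · exact absurd hy hyx
      · exact hy)) hcl)
  · have hxS : x ∈ S := hx.resolve_left hne
    have h₁ : x ∈ acl L ((Z ∪ S \ {x}) ∪ {b}) := h.mono _ _ (by
      rintro y (hy | ⟨hy | hy, hyx⟩)
      · exact Or.inl (Or.inl hy)
      · exact Or.inr hy
      · exact Or.inl (Or.inr ⟨hy, hyx⟩)) hcl
    refine hb (h.mono _ _ ?_ (h.exchange _ _ _ h₁ (hS x hxS)))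
    rintro y ((hy | hy) | rfl)
    · exact Or.inl hy
    · exact Or.inr hy.1
    · exact Or.inr hxS

theorem exists_basis (h : IsPregeometry (acl L : Set M → Set M)) (hX : X.Finite) (Z : Set M) :
    ∃ E ⊆ X, AclIndep L E Z ∧ X ⊆ acl L (Z ∪ E) := by
  induction X, hX using Set.Finite.induction_on with
  | empty => exact ⟨∅, subset_rfl, fun b hb => hb.elim, Set.empty_subset _⟩
  | @insert a X _ _ ih =>
    obtain ⟨E, hE, hi, hs⟩ := ih
    by_cases ha : a ∈ acl L (Z ∪ E)
    · exact ⟨E, hE.trans (Set.subset_insert _ _), hi, Set.insert_subset ha hs⟩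
    · refine ⟨insert a E, Set.insert_subset_insert hE, hi.insert h ha, Set.insert_subset ?_ ?_⟩
      · exact h.subset_cl _ (Or.inr (Set.mem_insert _ _))
      · exact hs.trans (h.mono _ _ (Set.union_subset_union_right _ (Set.subset_insert _ _)))

/-- A set that is independent over `Z ⊆ A` and algebraic over `Z ∪ E`, where `E` is independent over
`A`, is independent over `A`. -/
theorem aclIndep_of_subset_acl (h : IsPregeometry (acl L : Set M → Set M)) (hE : E.Finite)
    (hEA : AclIndep L E A) (hZ : Z ⊆ A) (hS : S.Finite) (hSE : S ⊆ acl L (Z ∪ E))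
    (hSZ : AclIndep L S Z) : AclIndep L S A := by
  -- Steinitz exchange: elements of `E` are replaced one at a time by elements of `S`. Independence
  -- is kept over the large set `A`, while spanning is kept over the small set `Z`.
  suffices H : ∃ E₁ ⊆ E, AclIndep L (S ∪ E₁) A ∧ E ⊆ acl L (Z ∪ (S ∪ E₁)) by
    obtain ⟨E₁, -, hi, -⟩ := H
    exact hi.subset h Set.subset_union_left
  induction S, hS using Set.Finite.induction_on with
  | empty =>
    refine ⟨E, subset_rfl, by rwa [Set.empty_union], ?_⟩
    rw [Set.empty_union]
    exact Set.subset_union_right.trans (h.subset_cl _)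
  | @insert s S hsS _ ih =>
    obtain ⟨E₁, hE₁, hi, hsp⟩ := ih ((Set.subset_insert _ _).trans hSE)
      (hSZ.subset h (Set.subset_insert _ _))
    have hs : s ∉ acl L (Z ∪ S) := by
      have := hSZ s (Set.mem_insert _ _)
      rwa [Set.insert_sdiff_self_of_notMem hsS] at this
    have hs₁ : s ∈ acl L (Z ∪ (S ∪ E₁)) :=
      h.cl_subset (Set.union_subset (Set.subset_union_left.trans (h.subset_cl _)) hsp)
        (hSE (Set.mem_insert _ _))
    -- Any element `e` of a minimal `F` is really needed for `s`. Hence `e` and `s` are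
    -- interalgebraic over the remaining elements, and `s` can take the place of `e`.
    obtain ⟨F, hF⟩ := Set.Finite.exists_minimal
      (s := {F | F ⊆ E₁ ∧ s ∈ acl L (Z ∪ (S ∪ F))})
      ((hE.subset hE₁).finite_subsets.subset fun F hF => hF.1) ⟨E₁, subset_rfl, hs₁⟩
    obtain ⟨e, he⟩ : F.Nonempty := by
      by_contra hne
      rw [Set.not_nonempty_iff_eq_empty] at hne
      have := hF.prop.2
      rw [hne, Set.union_empty] at this
      exact hs this
    have hF' : s ∉ acl L (Z ∪ (S ∪ F \ {e})) := fun hmem =>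
      ((hF.le_of_le ⟨Set.sdiff_subset.trans hF.prop.1, hmem⟩ Set.sdiff_subset) he).2 rfl
    have heS : e ∉ S := fun heS => hF' <| h.mono _ _ (by
      rintro y (hy | hy | hy)
      · exact Or.inl hy
      · exact Or.inr (Or.inl hy)
      · rcases eq_or_ne y e with rfl | hne
        · exact Or.inr (Or.inl heS)
        · exact Or.inr (Or.inr ⟨hy, hne⟩)) hF.prop.2
    have hex : e ∈ acl L ((Z ∪ (S ∪ F \ {e})) ∪ {s}) := h.exchange _ _ _ (h.mono _ _ (by
      rintro y (hy | hy | hy)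
      · exact Or.inl (Or.inl hy)
      · exact Or.inl (Or.inr (Or.inl hy))
      · rcases eq_or_ne y e with rfl | hne
        · exact Or.inr rfl
        · exact Or.inl (Or.inr (Or.inr ⟨hy, hne⟩))) hF.prop.2) hF'
    have heA : e ∉ acl L (A ∪ (S ∪ E₁ \ {e})) := fun hmem =>
      hi e (Or.inr (hF.prop.1 he)) (h.mono _ _ (by
        rintro y (hy | hy | hy)
        · exact Or.inl hy
        · exact Or.inr ⟨Or.inl hy, fun hye => heS (hye ▸ hy)⟩
        · exact Or.inr ⟨Or.inr hy.1, hy.2⟩) hmem)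
    have hsA : s ∉ acl L (A ∪ (S ∪ E₁ \ {e})) := fun hmem => by
      refine heA (h.cl_subset ?_ hex)
      rintro y ((hy | hy | hy) | rfl)
      · exact h.subset_cl _ (Or.inl (hZ hy))
      · exact h.subset_cl _ (Or.inr (Or.inl hy))
      · exact h.subset_cl _ (Or.inr (Or.inr ⟨hF.prop.1 hy.1, hy.2⟩))
      · exact hmem
    refine ⟨E₁ \ {e}, Set.sdiff_subset.trans hE₁, ?_, ?_⟩
    · rw [Set.insert_union]
      exact (hi.subset h (Set.union_subset_union_right _ Set.sdiff_subset)).insert h hsA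
    · refine hsp.trans (h.cl_subset ?_)
      rintro y (hy | hy | hy)
      · exact h.subset_cl _ (Or.inl hy)
      · exact h.subset_cl _ (Or.inr (Or.inl (Or.inr hy)))
      · rcases eq_or_ne y e with rfl | hne
        · refine h.mono _ _ ?_ hex
          rintro z ((hz | hz | hz) | rfl)
          · exact Or.inl hz
          · exact Or.inr (Or.inl (Or.inr hz))
          · exact Or.inr (Or.inr ⟨hF.prop.1 hz.1, hz.2⟩)
          · exact Or.inr (Or.inl (Or.inl rfl))
        · exact h.subset_cl _ (Or.inr (Or.inr ⟨hy, hne⟩))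

end Pregeometry

/-! ### Types of tuples and algebraic closure -/

section Acl

variable {L : FirstOrder.Language.{u, v}} {M : Type w} [L.Structure M] {N : Type x} [L.Structure N]
variable {ι κ : Type*}

/-- The tuples `c` and `c'` satisfy the same formulas. -/
def SameType (L : FirstOrder.Language.{u, v}) {M : Type w} [L.Structure M] {N : Type x}
    [L.Structure N] (c : ι → M) (c' : ι → N) : Prop :=
  ∀ φ : L.Formula ι, φ.Realize c ↔ φ.Realize c'

theorem SameType.symm {c : ι → M} {c' : ι → N} (h : SameType L c c') : SameType L c' c :=
  fun φ => (h φ).symm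

theorem SameType.comp {c : ι → M} {c' : ι → N} (h : SameType L c c') (f : κ → ι) :
    SameType L (c ∘ f) (c' ∘ f) := fun φ => by
  simpa only [Formula.realize_relabel] using h (φ.relabel f)

theorem SameType.eq_iff {c : ι → M} {c' : ι → N} (h : SameType L c c') (i j : ι) :
    c i = c j ↔ c' i = c' j := by
  simpa only [Formula.realize_equal, Term.realize_var] using
    h (Term.equal (Term.var i) (Term.var j))

theorem mem_acl_iff {X : Set M} {b : M} :
    b ∈ acl L X ↔ ∃ φ : L.Formula (X ⊕ Unit), HoldsAt φ b ∧ {y | HoldsAt φ y}.Finite := by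
  have key : ∀ (φ : L.Formula (X ⊕ Fin 1)) (y : M),
      HoldsAt (φ.relabel (Sum.map id fun _ => ()) : L.Formula (X ⊕ Unit)) y ↔
        φ.Realize (Sum.elim (↑) fun _ => y) := fun φ y => by
    rw [HoldsAt, Formula.realize_relabel, Sum.elim_comp_map]
    rfl
  have key' : ∀ (φ : L.Formula (X ⊕ Unit)) (y : M),
      (φ.relabel (Sum.map id fun _ => 0) : L.Formula (X ⊕ Fin 1)).Realize
        (Sum.elim (↑) fun _ => y) ↔ HoldsAt φ y := fun φ y => by
    rw [HoldsAt, Formula.realize_relabel, Sum.elim_comp_map]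
    rfl
  constructor
  · rintro ⟨s, hs, hfin, hb⟩
    obtain ⟨φ, hφ⟩ := Set.definable_iff_exists_formula_sum.1 hs
    have h : ∀ y, y ∈ s ↔ φ.Realize (Sum.elim (↑) fun _ => y) := fun y =>
      Set.ext_iff.1 hφ fun _ => y
    refine ⟨φ.relabel (Sum.map id fun _ => ()), (key φ b).2 ((h b).1 hb), ?_⟩
    refine hfin.subset fun y hy => (h y).2 ((key φ y).1 hy)
  · rintro ⟨φ, hb, hfin⟩
    refine ⟨_, ?_, hfin, hb⟩
    refine Set.definable_iff_exists_formula_sum.2 ⟨φ.relabel (Sum.map id fun _ => 0), ?_⟩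
    ext y
    have : y = fun _ => y 0 := funext fun i => by rw [Subsingleton.elim i 0]
    rw [Set.mem_ofPred_eq, this]
    exact (key' φ (y 0)).symm

theorem mem_acl_range_iff {c : ι → M} {b : M} : b ∈ acl L (Set.range c) ↔
    ∃ φ : L.Formula (ι ⊕ Unit), φ.Realize (Sum.elim c fun _ => b) ∧
      {y | φ.Realize (Sum.elim c fun _ => y)}.Finite := by
  rw [mem_acl_iff]
  choose s hs using fun x : Set.range c => x.2
  constructor
  · rintro ⟨φ, hb, hfin⟩
    have key : ∀ y, (φ.relabel (Sum.map s id)).Realize (Sum.elim c fun _ => y) ↔ HoldsAt φ y :=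
      fun y => by
        rw [HoldsAt, Formula.realize_relabel, Sum.elim_comp_map, show c ∘ s = (↑) from funext hs]
        rfl
    exact ⟨φ.relabel (Sum.map s id), (key b).2 hb, by simpa only [key] using hfin⟩
  · rintro ⟨φ, hb, hfin⟩
    have key : ∀ y, HoldsAt (φ.relabel (Sum.map (Set.rangeFactorization c) id)) y ↔
        φ.Realize (Sum.elim c fun _ => y) := fun y => by
      rw [HoldsAt, Formula.realize_relabel, Sum.elim_comp_map]
      rfl
    exact ⟨φ.relabel (Sum.map (Set.rangeFactorization c) id), (key b).2 hb,
      by simpa only [key] using hfin⟩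

/-- There are at least `k` elements `y` with `φ(x,y)`. -/
noncomputable def countGe (φ : L.Formula (ι ⊕ Unit)) (k : ℕ) : L.Formula ι :=
  Formula.iExs (Fin k)
    ((Formula.iInf fun p : {p : Fin k × Fin k // p.1 ≠ p.2} =>
      ((Term.var (Sum.inr p.1.1)).equal (Term.var (Sum.inr p.1.2))).not) ⊓
    Formula.iInf fun i : Fin k => φ.relabel (Sum.map id fun _ => i))

theorem realize_countGe {φ : L.Formula (ι ⊕ Unit)} {k : ℕ} {c : ι → M} :
    (countGe φ k).Realize c ↔ ∃ y : Fin k → M, Function.Injective y ∧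
      ∀ i, φ.Realize (Sum.elim c fun _ => y i) := by
  rw [countGe, Formula.realize_iExs]
  refine exists_congr fun y => ?_
  rw [Formula.realize_inf, Formula.realize_iInf, Formula.realize_iInf]
  refine and_congr ⟨fun h i j hij => ?_, fun h p => ?_⟩ (forall_congr' fun i => ?_)
  · by_contra hne
    have := h ⟨(i, j), hne⟩
    rw [Formula.realize_not, Formula.realize_equal] at this
    exact this hij
  · rw [Formula.realize_not, Formula.realize_equal]
    exact fun e => p.2 (h e)
  · rw [Formula.realize_relabel, Sum.elim_comp_map]
    rfl

theorem infinite_iff_countGe {φ : L.Formula (ι ⊕ Unit)} {c : ι → M} :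
    {y | φ.Realize (Sum.elim c fun _ => y)}.Infinite ↔ ∀ k, (countGe φ k).Realize c := by
  simp only [realize_countGe]
  constructor
  · intro h k
    have := h.to_subtype
    let e := Infinite.natEmbedding {y | φ.Realize (Sum.elim c fun _ => y)}
    exact ⟨fun i => (e i : M), fun i j hij => Fin.ext (e.injective (Subtype.ext hij)),
      fun i => (e i).2⟩
  · intro h hfin
    obtain ⟨y, hy, hφ⟩ := h (hfin.toFinset.card + 1)
    have := Finset.card_le_card_of_injOn (s := Finset.univ) (t := hfin.toFinset) y
      (fun i _ => by simpa using hφ i) hy.injOn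
    simp at this

/-- Finiteness of the solution set is thereby witnessed by a single formula about the parameters, so
it is visible in their type and transfers between structures. -/
theorem finite_iff_countGe {φ : L.Formula (ι ⊕ Unit)} {c : ι → M} :
    {y | φ.Realize (Sum.elim c fun _ => y)}.Finite ↔ ∃ k, ¬ (countGe φ k).Realize c := by
  rw [← Set.not_infinite, infinite_iff_countGe, not_forall]

theorem SameType.finite_iff {c : ι → M} {c' : ι → N} (h : SameType L c c')
    (φ : L.Formula (ι ⊕ Unit)) : {y | φ.Realize (Sum.elim c fun _ => y)}.Finite ↔
      {y | φ.Realize (Sum.elim c' fun _ => y)}.Finite := by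
  simp only [finite_iff_countGe, h _]

theorem SameType.mem_acl {c : ι → M} {c' : ι → N} (h : SameType L c c') {i : ι} {f : κ → ι}
    (hi : c i ∈ acl L (Set.range (c ∘ f))) : c' i ∈ acl L (Set.range (c' ∘ f)) := by
  obtain ⟨φ, hφ, hfin⟩ := mem_acl_range_iff.1 hi
  refine mem_acl_range_iff.2 ⟨φ, ?_, ((h.comp f).finite_iff φ).1 hfin⟩
  have h' := h (φ.relabel (Sum.elim f fun _ => i))
  rw [Formula.realize_relabel, Formula.realize_relabel, Sum.comp_elim, Sum.comp_elim] at h'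
  exact h'.1 hφ

/-- The existential closure of a finite conjunction is one formula in the common type of `c` and
`c'`. -/
theorem SameType.finSat {c : ι → M} {c' : ι → N} (h : SameType L c c') {b : M}
    {F : Set (L.Formula (ι ⊕ Unit))} (hF : F.Finite)
    (hb : ∀ φ ∈ F, φ.Realize (Sum.elim c fun _ => b)) :
    ∃ b' : N, ∀ φ ∈ F, φ.Realize (Sum.elim c' fun _ => b') := by
  have := hF.to_subtype
  have hex : (Formula.iExs Unit (Formula.iInf fun ψ : F => ψ.1)).Realize c :=
    Formula.realize_iExs.2 ⟨fun _ => b, Formula.realize_iInf.2 fun ψ => hb ψ.1 ψ.2⟩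
  obtain ⟨y, hy⟩ := Formula.realize_iExs.1 ((h _).1 hex)
  exact ⟨y (), fun φ hφ => Formula.realize_iInf.1 hy ⟨φ, hφ⟩⟩

end Acl

/-! ### Pairs and relativization -/

section Relativization

variable {L Eβ Eα : FirstOrder.Language.{u, v}}
variable {M : Type w} [L.Structure M] [Eβ.Structure M] [Eα.Structure M] [predLang.Structure M]
variable {Tβ : (langB L Eβ).Theory} {Tα : (langA L Eα).Theory}

theorem realize_relativize {K : Type x} [(langA L Eα).Structure K] (j : K ↪[langA L Eα] M)
    (hj : Set.range j = setA M) {γ : Type y} {n : ℕ} (θ : (langA L Eα).BoundedFormula γ n)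
    (a : γ → K) (b : Fin n → K) :
    (relativize Eβ θ).Realize (j ∘ a) (j ∘ b) ↔ θ.Realize a b := by
  induction θ with
  | falsum => exact Iff.rfl
  | equal t₁ t₂ =>
    simp only [relativize, BoundedFormula.Realize, LHom.realize_onTerm, ← Sum.comp_elim,
      HomClass.realize_term, j.injective.eq_iff]
  | rel R ts =>
    simp only [relativize, BoundedFormula.Realize, LHom.realize_onTerm, ← Sum.comp_elim,
      HomClass.realize_term]
    rw [LHom.map_onRelation]
    exact j.map_rel R fun i => (ts i).realize (Sum.elim a b)
  | imp θ₁ θ₂ ih₁ ih₂ => simp only [relativize, BoundedFormula.Realize, ih₁, ih₂]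
  | all θ ih =>
    simp only [relativize, BoundedFormula.realize_all, BoundedFormula.realize_imp, realize_predA]
    simp only [Term.realize_var, Sum.elim_inr, Fin.snoc_last, ← hj]
    constructor
    · intro h y
      rw [← ih]
      have := h (j y) ⟨y, rfl⟩
      rwa [← Fin.comp_snoc] at this
    · rintro h _ ⟨y, rfl⟩
      rw [← Fin.comp_snoc, ih]
      exact h y

theorem realize_relFormula {K : Type x} [(langA L Eα).Structure K] (j : K ↪[langA L Eα] M)
    (hj : Set.range j = setA M) {γ : Type y} (θ : (langA L Eα).Formula γ) (a : γ → K) :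
    (relFormula Eβ θ).Realize (j ∘ a) ↔ θ.Realize a := by
  rw [Formula.Realize, relFormula, Formula.Realize, ← realize_relativize (Eβ := Eβ) j hj]
  exact iff_of_eq (congrArg (fun b => (relativize Eβ θ).Realize (j ∘ a) b) (Subsingleton.elim _ _))

theorem realize_relFormula_structA (hM : M ⊨ pairTheory Tβ Tα) {γ : Type y}
    (θ : (langA L Eα).Formula γ) (a : γ → structA hM) :
    (relFormula Eβ θ).Realize (fun i => (a i : M)) ↔ θ.Realize a :=
  realize_relFormula (structA hM).subtype
    (Subtype.range_coe_subtype.trans rfl) θ a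

theorem model_langB (hM : M ⊨ pairTheory Tβ Tα) : M ⊨ Tβ :=
  (LHom.onTheory_model (inclB L Eβ Eα) Tβ).1
    (hM.mono fun _ h => Or.inl (Or.inl (Or.inl h)))

theorem realize_sentence_structA (hM : M ⊨ pairTheory Tβ Tα) {σ : (langA L Eα).Sentence}
    (h : Tα ⊨ᵇ σ) : σ.Realize (structA hM) := by
  have h₁ : M ⊨ relFormula Eβ σ :=
    hM.realize_of_mem _ (Or.inl (Or.inl (Or.inr ⟨σ, h, rfl⟩)))
  refine (realize_relFormula_structA hM σ default).1 ?_
  rw [Sentence.Realize] at h₁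
  exact (iff_of_eq (congrArg _ (Subsingleton.elim _ _))).1 h₁

theorem model_structA (hM : M ⊨ pairTheory Tβ Tα) : structA hM ⊨ Tα :=
  ⟨fun _ hσ => realize_sentence_structA hM (Theory.models_sentence_of_mem hσ)⟩

/-- Models are nonempty, so `Tα` entails `∃ x, ⊤`, whose relativization says that `A` is nonempty.
-/
theorem nonempty_structA (hM : M ⊨ pairTheory Tβ Tα) : Nonempty (structA hM) := by
  have h : Tα ⊨ᵇ (BoundedFormula.ex ⊤ : (langA L Eα).Sentence) := fun N v xs => by
    rw [BoundedFormula.realize_ex]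
    exact ⟨Classical.arbitrary N, BoundedFormula.realize_top.2 trivial⟩
  have := realize_sentence_structA hM h
  rw [Sentence.Realize, Formula.Realize, BoundedFormula.realize_ex] at this
  exact ⟨this.choose⟩

theorem mem_setA_of_relMap (hM : M ⊨ pairTheory Tβ Tα) {n : ℕ} (R : Eα.Relations n)
    (a : Fin n → M) (h : Structure.RelMap R a) (i : Fin n) : a i ∈ setA M := by
  have h₁ := hM.realize_of_mem (supportAxiom Eβ R) (Or.inr ⟨n, R, rfl⟩)
  rw [supportAxiom, Sentence.Realize, BoundedFormula.realize_alls] at h₁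
  have h₂ := h₁ a
  rw [BoundedFormula.realize_imp, allInA, BoundedFormula.realize_iInf] at h₂
  have := h₂ h i
  rwa [realize_predA] at this

theorem realize_onFormula_inclB {γ : Type y} (φ : (langB L Eβ).Formula γ) (a : γ → M) :
    ((inclB L Eβ Eα).onFormula φ).Realize a ↔ φ.Realize a :=
  LHom.realize_onFormula _ _

end Relativization

/-! ### Elementary maps of pairs -/

section PairMaps

variable {L Eβ Eα : FirstOrder.Language.{u, v}}
variable {M : Type w} [L.Structure M] [Eβ.Structure M] [Eα.Structure M] [predLang.Structure M]
variable {N : Type x} [L.Structure N] [Eβ.Structure N] [Eα.Structure N] [predLang.Structure N]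
variable {ι κ : Type*}

theorem sameType_of_elementaryEmbedding {L : FirstOrder.Language.{u, v}} {M : Type w}
    [L.Structure M] {N : Type x} [L.Structure N] (j : M ↪ₑ[L] N) (c : ι → M) :
    SameType L c (j ∘ c) := fun φ => (j.map_formula φ c).symm

theorem SameType.langB {c : ι → M} {c' : ι → N} (h : SameType (lang2 L Eβ Eα) c c') :
    SameType (langB L Eβ) c c' := fun φ => by
  simpa only [realize_onFormula_inclB] using h ((inclB L Eβ Eα).onFormula φ)

theorem realize_predA_formula (t : (lang2 L Eβ Eα).Term ι) (c : ι → M) :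
    ((predA L Eβ Eα).formula₁ t).Realize c ↔ t.realize c ∈ setA M := by
  rw [Formula.realize_rel₁]
  rfl

theorem SameType.mem_setA_iff {c : ι → M} {c' : ι → N} (h : SameType (lang2 L Eβ Eα) c c') (i : ι) :
    c i ∈ setA M ↔ c' i ∈ setA N := by
  simpa only [realize_predA_formula, Term.realize_var] using
    h ((predA L Eβ Eα).formula₁ (Term.var i))

theorem mem_setA_iff_of_elementaryEmbedding (j : M ↪ₑ[lang2 L Eβ Eα] N) (b : M) :
    j b ∈ setA N ↔ b ∈ setA M :=
  ((sameType_of_elementaryEmbedding j fun _ : Unit => b).mem_setA_iff ()).symm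

theorem SameType.mem_acl_image {L : FirstOrder.Language.{u, v}} {M : Type w}
    [L.Structure M] {N : Type x} [L.Structure N] {c : ι → M} {c' : ι → N} (h : SameType L c c')
    {i : ι} {s : Set ι} (hi : c i ∈ acl L (c '' s)) : c' i ∈ acl L (c' '' s) := by
  rw [← Subtype.range_coe (s := s), ← Set.range_comp] at hi ⊢
  exact h.mem_acl hi

/-- Algebraicity over the predicate and further elements is reflected by elementary maps of
pairs. -/
theorem mem_acl_setA_of_elementaryEmbedding
    (hN : IsPregeometry (acl (langB L Eβ) : Set N → Set N))
    (hM : IsPregeometry (acl (langB L Eβ) : Set M → Set M)) 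
    (j : M ↪ₑ[lang2 L Eβ Eα] N) {X : Set M} {b : M} (h : j b ∈ acl (langB L Eβ) (setA N ∪ j '' X)) :
    b ∈ acl (langB L Eβ) (setA M ∪ X) := by
  classical
  obtain ⟨F, hF, hFfin, hb⟩ := hN.finitary _ _ h
  have := hFfin.to_subtype
  rw [← Subtype.range_coe (s := F)] at hb
  obtain ⟨φ, hφ, hfin⟩ := mem_acl_range_iff.1 hb
  obtain ⟨k, hk⟩ := finite_iff_countGe.1 hfin
  have hex : ∀ z : F, (z : N) ∉ setA N → ∃ x ∈ X, j x = z := fun z hz =>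
    (hF z.2).resolve_left hz
  have : Nonempty M := ⟨b⟩
  choose! pre hpre using hex
  let FA := {z : F // (z : N) ∈ setA N}
  let ρ : F → M ⊕ FA := fun z => if hz : (z : N) ∈ setA N then Sum.inr ⟨z, hz⟩ else Sum.inl (pre z)
  -- Parameters from `A` are quantified away within `A`; the others are images of elements of `X`
  -- and are kept. The negated `countGe` records that `φ` has fewer than `k` solutions.
  let Φ : (lang2 L Eβ Eα).Formula M := Formula.iExs FA
    ((Formula.iInf fun z : FA => (predA L Eβ Eα).formula₁ (Term.var (Sum.inr z))) ⊓
      ((inclB L Eβ Eα).onFormula (φ.relabel (Sum.elim ρ fun _ => Sum.inl b)) ⊓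
        (inclB L Eβ Eα).onFormula ((countGe φ k).relabel ρ).not))
  have hN' : Φ.Realize j := by
    refine Formula.realize_iExs.2 ⟨fun z => (z.1 : N), ?_⟩
    have e : Sum.elim j (fun z : FA => (z.1 : N)) ∘ ρ = (↑) := by
      funext z
      by_cases hz : (z : N) ∈ setA N
      · simp [ρ, hz]
      · simp [ρ, hz, (hpre z hz).2]
    rw [Formula.realize_inf, Formula.realize_inf, Formula.realize_iInf, realize_onFormula_inclB,
      realize_onFormula_inclB, Formula.realize_not, Formula.realize_relabel,
      Formula.realize_relabel, Sum.comp_elim, e]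
    exact ⟨fun z => (realize_predA_formula _ _).2 z.2, hφ, hk⟩
  have hM' : Φ.Realize (id : M → M) := (j.map_formula Φ id).1 hN'
  obtain ⟨a, ha⟩ := Formula.realize_iExs.1 hM'
  rw [Formula.realize_inf, Formula.realize_inf, Formula.realize_iInf, realize_onFormula_inclB,
    realize_onFormula_inclB, Formula.realize_not, Formula.realize_relabel,
    Formula.realize_relabel, Sum.comp_elim] at ha
  refine hM.mono (Set.range (Sum.elim id a ∘ ρ)) _ ?_
    (mem_acl_range_iff.2 ⟨φ, ha.2.1, finite_iff_countGe.2 ⟨k, ha.2.2⟩⟩)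
  rintro _ ⟨z, rfl⟩
  by_cases hz : (z : N) ∈ setA N
  · refine Or.inl ?_
    have := (realize_predA_formula _ _).1 (ha.1 ⟨z, hz⟩)
    simpa [ρ, hz] using this
  · refine Or.inr ?_
    simpa [ρ, hz] using (hpre z hz).1

end PairMaps

/-! ### Configurations -/

section Good

variable {L Eβ Eα : FirstOrder.Language.{u, v}}
variable {Tβ : (langB L Eβ).Theory} {Tα : (langA L Eα).Theory}
variable {M : Type w} [L.Structure M] [Eβ.Structure M] [Eα.Structure M] [predLang.Structure M]
variable {N : Type x} [L.Structure N] [Eβ.Structure N] [Eα.Structure N] [predLang.Structure N]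
variable {hM : M ⊨ pairTheory Tβ Tα} {hN : N ⊨ pairTheory Tβ Tα}

variable (L Eβ) in
/-- The components of `c` in `A` are those with index in `pos`, and those with index in `E` form
a basis of `c` over them that remains independent over `A`. -/
structure FreeTuple {ι : Type*} (pos E : Set ι) (c : ι → M) : Prop where
  mem_iff : ∀ i, c i ∈ setA M ↔ i ∈ pos
  indep : AclIndep (langB L Eβ) (c '' E) (setA M)
  span : ∀ i, c i ∈ acl (langB L Eβ) (c '' (pos ∪ E))

theorem FreeTuple.comp_equiv {ι κ : Type*} {pos E : Set ι} {c : ι → M}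
    (h : FreeTuple L Eβ pos E c) (e : κ ≃ ι) : FreeTuple L Eβ (e ⁻¹' pos) (e ⁻¹' E) (c ∘ e) where
  mem_iff i := h.mem_iff (e i)
  indep := by
    rw [Set.image_comp, Set.image_preimage_eq _ e.surjective]
    exact h.indep
  span i := by
    rw [← Set.preimage_union, Set.image_comp, Set.image_preimage_eq _ e.surjective]
    exact h.span (e i)

/-- The tuples `c` and `c'` correspond to each other in the back-and-forth system. -/
structure Good (hM : M ⊨ pairTheory Tβ Tα) (hN : N ⊨ pairTheory Tβ Tα) {ι : Type}
    (c : ι → M) (c' : ι → N) : Prop where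
  elemB : SameType (langB L Eβ) c c'
  elemA : ∀ {κ : Type} (f : κ → ι) (a : κ → structA hM) (a' : κ → structA hN),
    (∀ k, (a k : M) = c (f k)) → (∀ k, (a' k : N) = c' (f k)) → SameType (langA L Eα) a a'
  free : ∃ pos E, FreeTuple L Eβ pos E c ∧ FreeTuple L Eβ pos E c'

variable {ι κ : Type} {c : ι → M} {c' : ι → N}

theorem Good.symm (h : Good hM hN c c') : Good hN hM c' c where
  elemB := h.elemB.symm
  elemA f a a' ha ha' := (h.elemA f a' a ha' ha).symm
  free := by
    obtain ⟨pos, E, h₁, h₂⟩ := h.free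
    exact ⟨pos, E, h₂, h₁⟩

theorem Good.mem_iff (h : Good hM hN c c') (i : ι) : c i ∈ setA M ↔ c' i ∈ setA N := by
  obtain ⟨pos, E, h₁, h₂⟩ := h.free
  rw [h₁.mem_iff, h₂.mem_iff]

theorem Good.comp_equiv (h : Good hM hN c c') (e : κ ≃ ι) : Good hM hN (c ∘ e) (c' ∘ e) where
  elemB := h.elemB.comp e
  elemA f a a' ha ha' := h.elemA (e ∘ f) a a' ha ha'
  free := by
    obtain ⟨pos, E, h₁, h₂⟩ := h.free
    exact ⟨_, _, h₁.comp_equiv e, h₂.comp_equiv e⟩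

/-- The predicate may grow from `M` to `N`, so independence over it is the point at issue. It
survives because elementary maps of pairs reflect algebraicity over the predicate. -/
theorem FreeTuple.map {ι : Type*} {c : ι → M} {pos E : Set ι} (h : FreeTuple L Eβ pos E c)
    (hM : IsPregeometry (acl (langB L Eβ) : Set M → Set M))
    (hN : IsPregeometry (acl (langB L Eβ) : Set N → Set N))
    (j : M ↪ₑ[lang2 L Eβ Eα] N) : FreeTuple L Eβ pos E (j ∘ c) where
  mem_iff i := (mem_setA_iff_of_elementaryEmbedding j (c i)).trans (h.mem_iff i)
  indep := by
    rw [Set.image_comp]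
    rintro _ ⟨b, hb, rfl⟩ hcl
    refine h.indep b hb (mem_acl_setA_of_elementaryEmbedding hN hM j ?_)
    rwa [Set.image_sdiff j.injective, Set.image_singleton]
  span i := (sameType_of_elementaryEmbedding j c).langB.mem_acl_image (h.span i)

/-- Correspondence of tuples is preserved by elementary maps of pairs. -/
theorem Good.map (h : Good hM hN c c')
    {M' : Type y} [L.Structure M'] [Eβ.Structure M'] [Eα.Structure M'] [predLang.Structure M']
    {hM' : M' ⊨ pairTheory Tβ Tα} (pM : IsPregeometry (acl (langB L Eβ) : Set M → Set M))
    (pM' : IsPregeometry (acl (langB L Eβ) : Set M' → Set M')) (j : M ↪ₑ[lang2 L Eβ Eα] M') :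
    Good hM' hN (j ∘ c) c' where
  elemB φ := by rw [← (sameType_of_elementaryEmbedding j c).langB φ, h.elemB φ]
  elemA f a a' ha ha' θ := by
    have hmem : ∀ k, c (f k) ∈ setA M := fun k =>
      (mem_setA_iff_of_elementaryEmbedding j _).1 (by
        have := (a k).2
        rw [ha k] at this
        exact this)
    rw [← h.elemA f (fun k => ⟨c (f k), hmem k⟩) a' (fun _ => rfl) ha' θ,
      ← realize_relFormula_structA, ← realize_relFormula_structA,
      ← j.map_formula (relFormula Eβ θ)]
    exact iff_of_eq (congrArg _ (funext ha))
  free := by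
    obtain ⟨pos, E, h₁, h₂⟩ := h.free
    exact ⟨pos, E, h₁.map pM pM' j, h₂⟩

/-- A single basis that is independent over `A` suffices: by `aclIndep_of_subset_acl` every subset
of the tuple independent over `c_α` is then independent over `A`. -/
theorem FreeTuple.contender {X : Challenge Tβ Tα} {E : Set (Fin X.n)} {c : Fin X.n → M}
    (hc : FreeTuple L Eβ X.pos E c) (hp : IsPregeometry (acl (langB L Eβ) : Set M → Set M))
    (hq : Realizes X.q c) (hA : ∀ θ : (langA L Eα).Formula X.pos, Formula.equivSentence θ ∈ X.p →
      (relFormula Eβ θ).Realize fun i : X.pos => c i) : X.IsContender c where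
  mem_iff := hc.mem_iff
  realizes_q := hq
  realizes_p := hA
  indep S hS hi := by
    have hsub : c '' X.pos ⊆ setA M := by
      rintro _ ⟨i, hi, rfl⟩
      exact (hc.mem_iff i).2 hi
    rw [Set.union_eq_self_of_subset_right hsub]
    refine aclIndep_of_subset_acl hp ((Set.toFinite E).image c) hc.indep hsub
      ((Set.finite_range c).subset hS) (fun s hs => ?_) hi
    obtain ⟨i, rfl⟩ := hS hs
    rw [← Set.image_union]
    exact hc.span i

end Good

/-! ### Types over corresponding tuples -/

section PullType

variable {L : FirstOrder.Language.{u, v}} {M : Type w} [L.Structure M] {N : Type x} [L.Structure N]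
variable {ι : Type*} {C : Set N}

/-- The image of the type of `b` over the tuple `c` in `M` under a correspondence of `c` with a
tuple in `N` that is given by an assignment `s` of indices to the elements of `C ⊆ N`. -/
def pullType (L : FirstOrder.Language.{u, v}) {M : Type w} [L.Structure M] (s : C → ι) (c : ι → M)
    (b : M) : Set (L.Formula (C ⊕ Unit)) :=
  {φ | (φ.relabel (Sum.map s id)).Realize (Sum.elim c fun _ => b)}

variable {s : C → ι} {c : ι → M} {c' : ι → N} {b : M}

theorem holdsAt_iff_relabel (hs : ∀ z, c' (s z) = z) (φ : L.Formula (C ⊕ Unit)) (y : N) :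
    HoldsAt φ y ↔ (φ.relabel (Sum.map s id)).Realize (Sum.elim c' fun _ => y) := by
  rw [HoldsAt, Formula.realize_relabel, Sum.elim_comp_map, show c' ∘ s = (↑) from funext hs]
  rfl

theorem isType_pullType (h : SameType L c c') (hs : ∀ z, c' (s z) = z) :
    IsType (pullType L s c b) := by
  refine ⟨fun F hF hfin => ?_, fun φ => ?_⟩
  · obtain ⟨b', hb'⟩ := h.finSat (hfin.image fun φ => φ.relabel (Sum.map s id)) (b := b) (by
      rintro _ ⟨φ, hφ, rfl⟩
      exact hF hφ)
    exact ⟨b', fun φ hφ => (holdsAt_iff_relabel hs φ b').2 (hb' _ ⟨φ, hφ, rfl⟩)⟩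
  · by_cases hφ : φ ∈ pullType L s c b
    · exact Or.inl hφ
    · refine Or.inr ?_
      rw [pullType, Set.mem_ofPred_eq, Formula.realize_relabel] at hφ ⊢
      exact Formula.realize_not.2 hφ

theorem nonAlgebraic_pullType (h : SameType L c c') (hs : ∀ z, c' (s z) = z)
    (hb : b ∉ acl L (Set.range c)) : NonAlgebraic (pullType L s c b) := by
  intro φ hφ
  simp only [holdsAt_iff_relabel hs]
  intro hfin
  exact hb (mem_acl_range_iff.2 ⟨_, hφ, (h.finite_iff _).2 hfin⟩)

theorem SameType.of_imp {c : ι → M} {c' : ι → N}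
    (h : ∀ φ : L.Formula ι, φ.Realize c → φ.Realize c') : SameType L c c' := fun φ =>
  ⟨h φ, fun hφ => by
    by_contra hn
    exact Formula.realize_not.1 (h φ.not (Formula.realize_not.2 hn)) hφ⟩

theorem sameType_of_pullType (h : SameType L c c') (hs : ∀ z, c' (s z) = z)
    (hC : ∀ i, c' i ∈ C) {b' : N} (hb' : ∀ φ ∈ pullType L s c b, HoldsAt φ b') :
    SameType L (Sum.elim c fun _ : Unit => b) (Sum.elim c' fun _ => b') := by
  refine SameType.of_imp fun φ hφ => ?_
  have := hb' (φ.relabel (Sum.map (fun i => ⟨c' i, hC i⟩) id)) (by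
    rw [pullType, Set.mem_ofPred_eq, Formula.realize_relabel, Formula.realize_relabel,
      Sum.elim_comp_map, Sum.elim_comp_map]
    -- The index chosen for `c' i` may differ from `i`, but equalities between components belong to
    -- the common type.
    have e : (c ∘ s) ∘ (fun i => ⟨c' i, hC i⟩ : ι → C) = c :=
      funext fun i => (h.eq_iff _ _).2 (hs ⟨c' i, hC i⟩)
    rw [e]
    exact hφ)
  rw [HoldsAt, Formula.realize_relabel, Sum.elim_comp_map] at this
  exact this

theorem IsSaturated.exists_realize {κ : Cardinal.{x}} (hN : IsSaturated (L := L) N κ)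
    (hκ : ℵ₀ ≤ κ) {ι : Type*} [Finite ι] (c : ι → N) (q : Set (L.Formula (ι ⊕ Unit)))
    (hq : ∀ F ⊆ q, F.Finite → ∃ b : N, ∀ φ ∈ F, φ.Realize (Sum.elim c fun _ => b)) :
    ∃ b : N, ∀ φ ∈ q, φ.Realize (Sum.elim c fun _ => b) := by
  have key : ∀ (φ : L.Formula (ι ⊕ Unit)) (y : N),
      HoldsAt (φ.relabel (Sum.map (Set.rangeFactorization c) id)) y ↔
        φ.Realize (Sum.elim c fun _ => y) := fun φ y => by
    rw [HoldsAt, Formula.realize_relabel, Sum.elim_comp_map]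
    rfl
  obtain ⟨b, hb⟩ := hN (Set.range c)
    ((Cardinal.lt_aleph0_iff_set_finite.2 (Set.finite_range c)).trans_le hκ)
    ((fun φ => φ.relabel (Sum.map (Set.rangeFactorization c) id)) '' q) (by
      intro G hG hGf
      obtain ⟨G', hG', hGf', rfl⟩ :=
        Set.exists_subset_image_finite_and.1 ⟨G, hG, hGf, rfl⟩
      obtain ⟨y, hy⟩ := hq G' hG' hGf'
      refine ⟨y, ?_⟩
      rintro _ ⟨φ, hφ, rfl⟩
      exact (key φ y).2 (hy φ hφ))
  exact ⟨b, fun φ hφ => (key φ b).1 (hb _ ⟨φ, hφ, rfl⟩)⟩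

end PullType

/-! ### Extension of corresponding tuples -/

section Extension

variable {L Eβ Eα : FirstOrder.Language.{u, v}}
variable {Tβ : (langB L Eβ).Theory} {Tα : (langA L Eα).Theory}

section General

variable {M : Type w} [L.Structure M] [Eβ.Structure M] [Eα.Structure M] [predLang.Structure M]
variable {N : Type x} [L.Structure N] [Eβ.Structure N] [Eα.Structure N] [predLang.Structure N]
variable {hM : M ⊨ pairTheory Tβ Tα} {hN : N ⊨ pairTheory Tβ Tα}
variable {ι κ : Type} {c : ι → M} {c' : ι → N} {pos E : Set ι} {b : M} {b' : N}

/-- The components of `c` in `A` as a tuple in the `L_α`-structure. -/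
def FreeTuple.tupleA (h : FreeTuple L Eβ pos E c) (hM : M ⊨ pairTheory Tβ Tα) :
    pos → structA hM := fun i => ⟨c i, (h.mem_iff i).2 i.2⟩

/-- A new element of `A` joins `pos`, algebraic over `c` or not; the basis over `A` is unaffected.
-/
theorem FreeTuple.snoc_mem (h : FreeTuple L Eβ pos E c)
    (hp : IsPregeometry (acl (langB L Eβ) : Set M → Set M)) (hb : b ∈ setA M) :
    FreeTuple L Eβ (Sum.inl '' pos ∪ {Sum.inr ()}) (Sum.inl '' E)
      (Sum.elim c fun _ : Unit => b) where
  mem_iff i := by cases i <;> simp [h.mem_iff, hb]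
  indep := by
    rw [← Set.image_comp, Sum.elim_comp_inl]
    exact h.indep
  span i := by
    cases i with
    | inl i =>
      refine hp.mono (c '' (pos ∪ E)) _ ?_ (h.span i)
      rintro _ ⟨i, hi | hi, rfl⟩
      · exact ⟨Sum.inl i, Or.inl (Or.inl ⟨i, hi, rfl⟩), rfl⟩
      · exact ⟨Sum.inl i, Or.inr ⟨i, hi, rfl⟩, rfl⟩
    | inr _ => exact hp.subset_cl _ ⟨Sum.inr (), Or.inl (Or.inr rfl), rfl⟩

theorem FreeTuple.snoc_of_mem_acl (h : FreeTuple L Eβ pos E c)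
    (hp : IsPregeometry (acl (langB L Eβ) : Set M → Set M)) (hb : b ∉ setA M)
    (hacl : b ∈ acl (langB L Eβ) (Set.range c)) :
    FreeTuple L Eβ (Sum.inl '' pos) (Sum.inl '' E) (Sum.elim c fun _ : Unit => b) where
  mem_iff i := by cases i <;> simp [h.mem_iff, hb]
  indep := by
    rw [← Set.image_comp, Sum.elim_comp_inl]
    exact h.indep
  span i := by
    rw [← Set.image_union, ← Set.image_comp, Sum.elim_comp_inl]
    cases i with
    | inl i => exact h.span i
    | inr _ =>
      refine hp.cl_subset ?_ hacl
      rintro _ ⟨i, rfl⟩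
      exact h.span i

/-- This is the only case in which the basis grows. -/
theorem FreeTuple.snoc_of_notMem_acl (h : FreeTuple L Eβ pos E c)
    (hp : IsPregeometry (acl (langB L Eβ) : Set M → Set M))
    (hacl : b ∉ acl (langB L Eβ) (setA M ∪ Set.range c)) :
    FreeTuple L Eβ (Sum.inl '' pos) (Sum.inl '' E ∪ {Sum.inr ()})
      (Sum.elim c fun _ : Unit => b) where
  mem_iff i := by
    have hb : b ∉ setA M := fun hb => hacl (hp.subset_cl _ (Or.inl hb))
    cases i <;> simp [h.mem_iff, hb]
  indep := by
    have e : (Sum.elim c fun _ : Unit => b) '' (Sum.inl '' E ∪ {Sum.inr ()}) =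
        insert b (c '' E) := by
      rw [Set.image_union, ← Set.image_comp, Sum.elim_comp_inl, Set.image_singleton,
        Set.union_singleton]
      rfl
    rw [e]
    refine h.indep.insert hp fun hmem => hacl (hp.mono _ _ ?_ hmem)
    exact Set.union_subset_union_right _ (Set.image_subset_range _ _)
  span i := by
    cases i with
    | inl i =>
      refine hp.mono (c '' (pos ∪ E)) _ ?_ (h.span i)
      rintro _ ⟨i, hi | hi, rfl⟩
      · exact ⟨Sum.inl i, Or.inl ⟨i, hi, rfl⟩, rfl⟩
      · exact ⟨Sum.inl i, Or.inr (Or.inl ⟨i, hi, rfl⟩), rfl⟩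
    | inr _ => exact hp.subset_cl _ ⟨Sum.inr (), Or.inr (Or.inr rfl), rfl⟩

/-- Since `b` lies outside `A`, a tuple from `𝓐` never uses the new index. -/
theorem sameType_structA_snoc (hA : ∀ {κ : Type} (f : κ → ι) (a : κ → structA hM)
      (a' : κ → structA hN), (∀ k, (a k : M) = c (f k)) → (∀ k, (a' k : N) = c' (f k)) →
      SameType (langA L Eα) a a') (hb : b ∉ setA M) {κ : Type} (f : κ → ι ⊕ Unit)
    (a : κ → structA hM) (a' : κ → structA hN)
    (ha : ∀ k, (a k : M) = Sum.elim c (fun _ => b) (f k))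
    (ha' : ∀ k, (a' k : N) = Sum.elim c' (fun _ => b') (f k)) : SameType (langA L Eα) a a' := by
  have hf : ∀ k, ∃ i, f k = Sum.inl i := fun k => by
    cases hk : f k with
    | inl i => exact ⟨i, rfl⟩
    | inr _ =>
      have hm : (a k : M) ∈ setA M := (a k).2
      rw [ha k, hk] at hm
      exact absurd hm hb
  choose g hg using hf
  exact hA g a a' (fun k => by rw [ha, hg]; rfl) fun k => by rw [ha', hg]; rfl

theorem Good.snoc_mem (h₁ : FreeTuple L Eβ pos E c)
    (h₂ : FreeTuple L Eβ pos E c') (pM : IsPregeometry (acl (langB L Eβ) : Set M → Set M))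
    (pN : IsPregeometry (acl (langB L Eβ) : Set N → Set N))
    (hb : b ∈ setA M) (hb' : b' ∈ setA N)
    (hB : SameType (langB L Eβ) (Sum.elim c fun _ : Unit => b) (Sum.elim c' fun _ => b'))
    (hA : SameType (langA L Eα)
      (Sum.elim (h₁.tupleA hM) fun _ : Unit => (⟨b, hb⟩ : structA hM))
      (Sum.elim (h₂.tupleA hN) fun _ => (⟨b', hb'⟩ : structA hN))) :
    Good hM hN (Sum.elim c fun _ : Unit => b) (Sum.elim c' fun _ => b') where
  elemB := hB
  elemA f a a' ha ha' := by
    have hf : ∀ k, ∃ i : pos ⊕ Unit, f k = Sum.map (↑) id i := fun k => by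
      cases hk : f k with
      | inl i =>
        have hm : (a k : M) ∈ setA M := (a k).2
        rw [ha k, hk] at hm
        exact ⟨Sum.inl ⟨i, (h₁.mem_iff i).1 hm⟩, rfl⟩
      | inr _ => exact ⟨Sum.inr (), rfl⟩
    choose g hg using hf
    have e₁ : a = (Sum.elim (h₁.tupleA hM) fun _ : Unit => (⟨b, hb⟩ : structA hM)) ∘ g := by
      funext k
      refine Subtype.ext ((ha k).trans ?_)
      rw [hg, Function.comp_apply]
      cases g k <;> rfl
    have e₂ : a' = (Sum.elim (h₂.tupleA hN) fun _ : Unit => (⟨b', hb'⟩ : structA hN)) ∘ g := by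
      funext k
      refine Subtype.ext ((ha' k).trans ?_)
      rw [hg, Function.comp_apply]
      cases g k <;> rfl
    rw [e₁, e₂]
    exact hA.comp g
  free := ⟨_, _, h₁.snoc_mem pM hb, h₂.snoc_mem pN hb'⟩

/-- Quantifier-free formulas of the common language have the same meaning in `𝓐` and in `𝓑`. -/
theorem realize_isQF_structA {γ : Type y} {n : ℕ} {χ : L.BoundedFormula γ n} (hχ : χ.IsQF)
    (a : γ → structA hM) (z : Fin n → structA hM) :
    ((LHom.sumInl : L →ᴸ langA L Eα).onBoundedFormula χ).Realize a z ↔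
      χ.Realize (fun i => (a i : M)) (fun i => (z i : M)) := by
  rw [← LHom.realize_onBoundedFormula (LHom.sumInl : L →ᴸ langA L Eα) (M := M)]
  have hterm : ∀ t : (langA L Eα).Term (γ ⊕ Fin n),
      t.realize (Sum.elim (fun i => (a i : M)) fun i => (z i : M)) =
        (t.realize (Sum.elim a z) : structA hM) := fun t => by
    have e : Sum.elim (fun i => (a i : M)) (fun i => (z i : M)) =
        (structA hM).subtype ∘ Sum.elim a z := by funext i; cases i <;> rfl
    rw [e]
    exact HomClass.realize_term (structA hM).subtype
  induction hχ with
  | falsum => exact Iff.rfl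
  | of_isAtomic h =>
    cases h with
    | equal t₁ t₂ =>
      simp only [LHom.onBoundedFormula, Term.bdEqual, BoundedFormula.Realize, hterm]
      exact Subtype.ext_iff
    | rel R ts =>
      simp only [LHom.onBoundedFormula, Relations.boundedFormula, BoundedFormula.Realize, hterm]
      rfl
  | imp _ _ ih₁ ih₂ =>
    simp only [LHom.onBoundedFormula, BoundedFormula.Realize, ih₁, ih₂]

end General

end Extension

/-! ### Back and forth in saturated models -/

section BackAndForth

variable {L Eβ Eα : FirstOrder.Language.{u, v}}
variable {Tβ : (langB L Eβ).Theory} {Tα : (langA L Eα).Theory} {T : (lang2 L Eβ Eα).Theory}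
variable {M : Type (max u v w)} [L.Structure M] [Eβ.Structure M] [Eα.Structure M]
  [predLang.Structure M]
variable {N : Type (max u v w)} [L.Structure N] [Eβ.Structure N] [Eα.Structure N]
  [predLang.Structure N]
variable {hM : M ⊨ pairTheory Tβ Tα} {hN : N ⊨ pairTheory Tβ Tα}

theorem isPregeometry_acl [Nonempty M] (hβ : IsGeometric.{u, v, w} Tβ) (hM : M ⊨ pairTheory Tβ Tα) :
    IsPregeometry (acl (langB L Eβ) : Set M → Set M) :=
  have := model_langB hM
  hβ.pregeometry M

/-! ### Matching one new element of $A$ -/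

section FinTuple

variable {n : ℕ} {c : Fin n → M} {c' : Fin n → N} {pos E : Set (Fin n)} {b : M}

/-- The types of `c` and of its part in `A`, with `φ` and `ψ`, form a challenge. It is solved by `c`
and `b`, and `c'` is another contender. -/
theorem Good.exists_mordellLang [Nonempty M] [M ⊨ T] [Nonempty N] [N ⊨ T]
    (hβ : IsGeometric.{u, v, w} Tβ) (hT : IsMLTheory.{u, v, w} Tβ Tα T)
    (h : Good hM hN c c') (h₁ : FreeTuple L Eβ pos E c) (h₂ : FreeTuple L Eβ pos E c')
    (hb : b ∈ setA M) (φ : (langB L Eβ).Formula (Fin n ⊕ Unit))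
    (ψ : (langA L Eα).Formula (pos ⊕ Unit)) (hφ : φ.Realize (Sum.elim c fun _ => b))
    (hfin : {y | φ.Realize (Sum.elim c fun _ => y)}.Finite)
    (hψ : ψ.Realize (Sum.elim (h₁.tupleA hM) fun _ => ⟨b, hb⟩)) :
    ∃ (b' : N) (hb' : b' ∈ setA N), φ.Realize (Sum.elim c' fun _ => b') ∧
      ψ.Realize (Sum.elim (h₂.tupleA hN) fun _ => ⟨b', hb'⟩) := by
  have := model_langB hM
  have := model_structA hM
  have := nonempty_structA hM
  obtain ⟨k, hk⟩ := finite_iff_countGe.1 hfin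
  let X : Challenge Tβ Tα :=
    { n := n
      pos := pos
      p := Tα.typeOf (h₁.tupleA hM)
      q := Tβ.typeOf c
      φ := φ
      ψ := ψ
      -- That `φ` has fewer than `k` solutions is part of the type of `c`, so the bound holds for
      -- every realization.
      finite := fun K d hd => finite_iff_countGe.2 ⟨k, Formula.realize_not.1 (hd _
        (Theory.CompleteType.formula_mem_typeOf.2 (Formula.realize_not.2 hk)))⟩ }
  have hA : SameType (langA L Eα) (h₁.tupleA hM) (h₂.tupleA hN) :=
    h.elemA (fun i => i.1) _ _ (fun _ => rfl) fun _ => rfl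
  have C₁ : X.IsContender c := FreeTuple.contender (X := X) (E := E) h₁ (isPregeometry_acl hβ hM)
    (fun φ hφ => Theory.CompleteType.formula_mem_typeOf.1 hφ) fun θ hθ =>
      (realize_relFormula_structA hM θ (h₁.tupleA hM)).2
        (Theory.CompleteType.formula_mem_typeOf.1 hθ)
  have C₂ : X.IsContender c' := FreeTuple.contender (X := X) (E := E) h₂ (isPregeometry_acl hβ hN)
    (fun φ hφ => (h.elemB φ).1 (Theory.CompleteType.formula_mem_typeOf.1 hφ)) fun θ hθ =>
      (realize_relFormula_structA hN θ (h₂.tupleA hN)).2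
        ((hA θ).1 (Theory.CompleteType.formula_mem_typeOf.1 hθ))
  have e : ∀ {K : Type (max u v w)} [L.Structure K] [Eβ.Structure K] [Eα.Structure K]
      [predLang.Structure K] {hK : K ⊨ pairTheory Tβ Tα} {d : Fin n → K}
      (hd : FreeTuple L Eβ pos E d) (y : K) (hy : y ∈ setA K),
      (relFormula Eβ ψ).Realize (Sum.elim (fun i : pos => d i) fun _ => y) ↔
        ψ.Realize (Sum.elim (hd.tupleA hK) fun _ => ⟨y, hy⟩) := by
    intro K _ _ _ _ hK d hd y hy
    rw [← realize_relFormula_structA]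
    refine iff_of_eq (congrArg _ (funext fun i => ?_))
    cases i <;> rfl
  obtain ⟨b', hb'⟩ := hT.mordellLang X ⟨M, _, _, _, _, ‹_›, ‹_›, c, b, C₁, hb, hφ,
    (e h₁ b hb).2 hψ⟩ N c' C₂
  exact ⟨b', hb'.mem, hb'.realize_φ, (e h₂ b' hb'.mem).1 hb'.realize_ψ⟩

/-- The Mordell–Lang condition matches one pair of formulas at a time; saturation of `N` matches
both types at once. -/
theorem Good.exists_algebraic [Nonempty M] [M ⊨ T] [Nonempty N] [N ⊨ T]
    (hβ : IsGeometric.{u, v, w} Tβ) (hT : IsMLTheory.{u, v, w} Tβ Tα T)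
    (h : Good hM hN c c') (h₁ : FreeTuple L Eβ pos E c) (h₂ : FreeTuple L Eβ pos E c')
    {κ : Cardinal.{max u v w}} (hκ : ℵ₀ ≤ κ) (hs : IsSaturated (L := lang2 L Eβ Eα) N κ)
    (hb : b ∈ setA M) (hacl : b ∈ acl (langB L Eβ) (Set.range c)) :
    ∃ (b' : N) (hb' : b' ∈ setA N),
      SameType (langB L Eβ) (Sum.elim c fun _ : Unit => b) (Sum.elim c' fun _ => b') ∧
      SameType (langA L Eα) (Sum.elim (h₁.tupleA hM) fun _ : Unit => ⟨b, hb⟩)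
        (Sum.elim (h₂.tupleA hN) fun _ => ⟨b', hb'⟩) := by
  obtain ⟨φ₀, hφ₀, hfin⟩ := mem_acl_range_iff.1 hacl
  let χ : (langB L Eβ).Formula (Fin n ⊕ Unit) → (langA L Eα).Formula (pos ⊕ Unit) →
      (lang2 L Eβ Eα).Formula (Fin n ⊕ Unit) := fun φ ψ =>
    (inclB L Eβ Eα).onFormula φ ⊓ ((relFormula Eβ ψ).relabel (Sum.map (↑) id) ⊓
      (predA L Eβ Eα).formula₁ (Term.var (Sum.inr ())))
  have hχ : ∀ φ ψ (y : N), (χ φ ψ).Realize (Sum.elim c' fun _ => y) ↔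
      φ.Realize (Sum.elim c' fun _ => y) ∧ ∃ hy : y ∈ setA N,
        ψ.Realize (Sum.elim (h₂.tupleA hN) fun _ => ⟨y, hy⟩) := by
    intro φ ψ y
    have e : ∀ hy : y ∈ setA N,
        (relFormula Eβ ψ).Realize (Sum.elim (c' ∘ ((↑) : pos → Fin n)) fun _ => y) ↔
        ψ.Realize (Sum.elim (h₂.tupleA hN) fun _ => ⟨y, hy⟩) := by
      intro hy
      rw [← realize_relFormula_structA]
      refine iff_of_eq (congrArg _ (funext fun i => ?_))
      cases i <;> rfl
    rw [Formula.realize_inf, Formula.realize_inf, realize_onFormula_inclB,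
      Formula.realize_relabel, realize_predA_formula, Sum.elim_comp_map]
    refine and_congr_right fun _ => ⟨fun h => ⟨h.2, (e h.2).1 h.1⟩, fun ⟨hy, h⟩ => ⟨(e hy).2 h, hy⟩⟩
  obtain ⟨b', hb'⟩ := hs.exists_realize hκ c' {θ | ∃ φ ψ,
      φ.Realize (Sum.elim c fun _ => b) ∧
      ψ.Realize (Sum.elim (h₁.tupleA hM) fun _ => ⟨b, hb⟩) ∧ θ = χ φ ψ} (by
    intro F hF hfinF
    have := hfinF.to_subtype
    choose φ ψ hφ hψ hθ using fun θ : F => hF θ.2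
    -- The conjunct `φ₀` keeps the formula algebraic, as a challenge requires.
    obtain ⟨b', hb', hφ', hψ'⟩ := h.exists_mordellLang hβ hT h₁ h₂ hb (φ₀ ⊓ Formula.iInf φ)
      (Formula.iInf ψ) (Formula.realize_inf.2 ⟨hφ₀, Formula.realize_iInf.2 hφ⟩)
      (hfin.subset fun y hy => (Formula.realize_inf.1 hy).1) (Formula.realize_iInf.2 hψ)
    refine ⟨b', fun θ hθF => ?_⟩
    rw [show θ = _ from hθ ⟨θ, hθF⟩, hχ]
    exact ⟨Formula.realize_iInf.1 (Formula.realize_inf.1 hφ').2 ⟨θ, hθF⟩, hb',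
      Formula.realize_iInf.1 hψ' ⟨θ, hθF⟩⟩)
  have key : ∀ (φ : (langB L Eβ).Formula (Fin n ⊕ Unit)) (ψ : (langA L Eα).Formula (pos ⊕ Unit)),
      φ.Realize (Sum.elim c fun _ => b) →
      ψ.Realize (Sum.elim (h₁.tupleA hM) fun _ => ⟨b, hb⟩) → _ := fun φ ψ hφ hψ =>
    (hχ φ ψ b').1 (hb' _ ⟨φ, ψ, hφ, hψ, rfl⟩)
  have htop : (⊤ : (langA L Eα).Formula (pos ⊕ Unit)).Realize
      (Sum.elim (h₁.tupleA hM) fun _ => ⟨b, hb⟩) := Formula.realize_top.2 trivial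
  refine ⟨b', (key φ₀ ⊤ hφ₀ htop).2.1, SameType.of_imp fun φ hφ => (key φ ⊤ hφ htop).1,
    SameType.of_imp fun ψ hψ => (key φ₀ ψ hφ₀ hψ).2.2⟩

/-- Density applies to the two types of `b` carried over to `c'`. They are compatible because
quantifier-free formulas of the common language mean the same in `𝓐` and `𝓑`. -/
theorem Good.exists_generic [Nonempty N] [N ⊨ T] (hT : IsMLTheory.{u, v, w} Tβ Tα T)
    (h : Good hM hN c c') (h₁ : FreeTuple L Eβ pos E c) (h₂ : FreeTuple L Eβ pos E c')
    {κ : Cardinal.{max u v w}} (hκ : Cardinal.lift.{w} (max ℵ₀ (lang2 L Eβ Eα).card) < κ)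
    (hs : IsSaturated (L := lang2 L Eβ Eα) N κ)
    (hb : b ∈ setA M) (hacl : b ∉ acl (langB L Eβ) (Set.range c)) :
    ∃ (b' : N) (hb' : b' ∈ setA N),
      SameType (langB L Eβ) (Sum.elim c fun _ : Unit => b) (Sum.elim c' fun _ => b') ∧
      SameType (langA L Eα) (Sum.elim (h₁.tupleA hM) fun _ : Unit => ⟨b, hb⟩)
        (Sum.elim (h₂.tupleA hN) fun _ => ⟨b', hb'⟩) := by
  have hκ' : ℵ₀ ≤ κ := by
    refine le_trans ?_ hκ.le
    rw [Cardinal.aleph0_le_lift]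
    exact le_max_left _ _
  have hA : SameType (langA L Eα) (h₁.tupleA hM) (h₂.tupleA hN) :=
    h.elemA (fun i => i.1) _ _ (fun _ => rfl) fun _ => rfl
  choose s hsc using fun z : Set.range c' => z.2
  let s' : {z : structA hN | (z : N) ∈ Set.range c'} → pos := fun z =>
    ⟨s ⟨z.1, z.2⟩, (h₂.mem_iff _).1 (by rw [hsc]; exact z.1.2)⟩
  have hs' : ∀ z, h₂.tupleA hN (s' z) = z := fun z => Subtype.ext (hsc ⟨z.1, z.2⟩)
  obtain ⟨b', hb', hq, hp⟩ := hT.density N κ hκ hs (Set.range c')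
    ((Cardinal.lt_aleph0_iff_set_finite.2 (Set.finite_range c')).trans_le hκ')
    (pullType (langB L Eβ) s c b) (isType_pullType h.elemB hsc)
    (nonAlgebraic_pullType h.elemB hsc hacl)
    (pullType (langA L Eα) s' (h₁.tupleA hM) ⟨b, hb⟩) (isType_pullType hA hs')
    (fun χ hχ hχp => by
      rw [pullType, Set.mem_ofPred_eq, Formula.realize_relabel, Sum.elim_comp_map] at hχp ⊢
      rw [LHom.realize_onFormula, Formula.realize_relabel]
      have := (realize_isQF_structA hχ _ _).1 hχp
      unfold Formula.Realize
      convert this using 1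
      funext i; cases i <;> rfl)
  refine ⟨b', hb', sameType_of_pullType h.elemB hsc (fun i => ⟨i, rfl⟩) hq,
    sameType_of_pullType hA hs' (fun i => ⟨i, rfl⟩) fun ψ hψ => ?_⟩
  rw [HoldsAt, ← realize_relFormula_structA]
  refine (iff_of_eq (congrArg _ (funext fun i => ?_))).1 (hp ψ hψ)
  cases i <;> rfl

end FinTuple

variable {ι : Type} [Finite ι] {c : ι → M} {c' : ι → N} {b : M}

theorem Good.exists_snoc_mem [Nonempty M] [M ⊨ T] [Nonempty N] [N ⊨ T]
    (hβ : IsGeometric.{u, v, w} Tβ) (hT : IsMLTheory.{u, v, w} Tβ Tα T)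
    {κ : Cardinal.{max u v w}} (hκ : Cardinal.lift.{w} (max ℵ₀ (lang2 L Eβ Eα).card) < κ)
    (hs : IsSaturated (L := lang2 L Eβ Eα) N κ) (h : Good hM hN c c') (hb : b ∈ setA M) :
    ∃ b' ∈ setA N, Good hM hN (Sum.elim c fun _ : Unit => b) (Sum.elim c' fun _ => b') := by
  have hκ' : ℵ₀ ≤ κ := by
    refine le_trans ?_ hκ.le
    rw [Cardinal.aleph0_le_lift]
    exact le_max_left _ _
  obtain ⟨n, ⟨e⟩⟩ := Finite.exists_equiv_fin ι
  have he := h.comp_equiv e.symm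
  obtain ⟨pos, E, h₁, h₂⟩ := he.free
  obtain ⟨b', hb', hB, hA⟩ : ∃ (b' : N) (hb' : b' ∈ setA N),
      SameType (langB L Eβ) (Sum.elim (c ∘ e.symm) fun _ : Unit => b)
        (Sum.elim (c' ∘ e.symm) fun _ => b') ∧
      SameType (langA L Eα) (Sum.elim (h₁.tupleA hM) fun _ : Unit => ⟨b, hb⟩)
        (Sum.elim (h₂.tupleA hN) fun _ => ⟨b', hb'⟩) := by
    by_cases hacl : b ∈ acl (langB L Eβ) (Set.range (c ∘ e.symm))
    · exact he.exists_algebraic hβ hT h₁ h₂ hκ' hs hb hacl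
    · exact he.exists_generic hT h₁ h₂ hκ hs hb hacl
  have hg := (Good.snoc_mem h₁ h₂ (isPregeometry_acl hβ hM) (isPregeometry_acl hβ hN) hb hb' hB
    hA).comp_equiv (Equiv.sumCongr e (Equiv.refl Unit))
  refine ⟨b', hb', ?_⟩
  convert hg using 1 <;> funext i <;> cases i <;> simp

/-- Some tuples that correspond to each other extend `c` and `c'`, where the extension of `c`
contains the elements of `F`. -/
def HasExtension {M N : Type w} [L.Structure M] [Eβ.Structure M] [Eα.Structure M]
    [predLang.Structure M] [L.Structure N] [Eβ.Structure N] [Eα.Structure N]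
    [predLang.Structure N] (hM : M ⊨ pairTheory Tβ Tα) (hN : N ⊨ pairTheory Tβ Tα) {ι : Type}
    (c : ι → M) (c' : ι → N) (F : Set M) : Prop :=
  ∃ (κ : Type) (_ : Finite κ) (d : κ → M) (d' : κ → N) (f : ι → κ),
    Good hM hN d d' ∧ d ∘ f = c ∧ d' ∘ f = c' ∧ F ⊆ Set.range d

theorem Good.hasExtension_snoc {b' : N}
    (h : Good hM hN (Sum.elim c fun _ : Unit => b) (Sum.elim c' fun _ => b')) :
    HasExtension hM hN c c' {b} :=
  ⟨ι ⊕ Unit, inferInstance, _, _, Sum.inl, h, Sum.elim_comp_inl _ _, Sum.elim_comp_inl _ _,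
    Set.singleton_subset_iff.2 ⟨Sum.inr (), rfl⟩⟩

theorem Good.hasExtension_of_finite (P : M → Prop)
    (hstep : ∀ {ι : Type} [Finite ι] {c : ι → M} {c' : ι → N}, Good hM hN c c' → ∀ b, P b →
      HasExtension hM hN c c' {b})
    (h : Good hM hN c c') {F : Set M} (hF : F.Finite) (hP : ∀ b ∈ F, P b) :
    HasExtension hM hN c c' F := by
  induction F, hF using Set.Finite.induction_on with
  | empty => exact ⟨ι, inferInstance, c, c', id, h, rfl, rfl, Set.empty_subset _⟩
  | @insert b F _ _ ih =>
    obtain ⟨κ, _, d, d', f, hd, rfl, rfl, hFd⟩ := ih fun x hx => hP x (Set.mem_insert_of_mem _ hx)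
    obtain ⟨κ', hκ', e, e', g, he, rfl, rfl, hb⟩ := hstep hd b (hP b (Set.mem_insert _ _))
    refine ⟨κ', hκ', e, e', g ∘ f, he, rfl, rfl, Set.insert_subset (hb rfl) ?_⟩
    exact hFd.trans (Set.range_comp_subset_range _ _)

theorem HasExtension.trans {ι κ : Type} {d : κ → M} {d' : κ → N} {f : ι → κ} {F : Set M}
    (h : HasExtension hM hN d d' F) : HasExtension hM hN (d ∘ f) (d' ∘ f) F := by
  obtain ⟨κ', hκ', e, e', g, he, rfl, rfl, hF⟩ := h
  exact ⟨κ', hκ', e, e', g ∘ f, he, rfl, rfl, hF⟩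

variable [Nonempty M] [Nonempty N] [N ⊨ T]

/-- An element algebraic over the tuple, but not in `A`. -/
theorem Good.hasExtension_of_mem_acl [M ⊨ T] (hβ : IsGeometric.{u, v, w} Tβ)
    (hT : IsMLTheory.{u, v, w} Tβ Tα T) {κ : Cardinal.{max u v w}}
    (hκ : Cardinal.lift.{w} (max ℵ₀ (lang2 L Eβ Eα).card) < κ)
    (hsM : IsSaturated (L := lang2 L Eβ Eα) M κ) (hsN : IsSaturated (L := lang2 L Eβ Eα) N κ)
    (h : Good hM hN c c') (hb : b ∉ setA M) (hacl : b ∈ acl (langB L Eβ) (Set.range c)) :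
    HasExtension hM hN c c' {b} := by
  have hκ' : ℵ₀ ≤ κ := by
    refine le_trans ?_ hκ.le
    rw [Cardinal.aleph0_le_lift]
    exact le_max_left _ _
  have pM := isPregeometry_acl hβ hM
  have pN := isPregeometry_acl hβ hN
  obtain ⟨φ, hφ, hfin⟩ := mem_acl_range_iff.1 hacl
  -- All of the finitely many solutions of `φ` that lie in `A` are first added to the tuple, so that
  -- the type over it tells `b` apart from them.
  obtain ⟨ι', hι', d, d', f, hd, rfl, rfl, hF⟩ := h.hasExtension_of_finite (· ∈ setA M)
    (fun h _ hb => (h.exists_snoc_mem hβ hT hκ hsN hb).choose_spec.2.hasExtension_snoc)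
    (hfin.inter_of_left (setA M)) fun _ hx => hx.2
  refine HasExtension.trans ?_
  have hacl' := pM.mono _ _ (Set.range_comp_subset_range f d) hacl
  obtain ⟨b', hb'⟩ := hsN.exists_realize hκ' d'
    {χ | ∃ θ : (langB L Eβ).Formula (ι' ⊕ Unit), θ.Realize (Sum.elim d fun _ => b) ∧
      χ = (inclB L Eβ Eα).onFormula θ} (by
    intro G hG hGf
    have := hGf.to_subtype
    choose θ hθ hθe using fun χ : G => hG χ.2
    obtain ⟨y, hy⟩ := hd.elemB.finSat (Set.finite_range θ) (b := b) (by
      rintro _ ⟨χ, rfl⟩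
      exact hθ χ)
    refine ⟨y, fun χ hχ => ?_⟩
    rw [show χ = _ from hθe ⟨χ, hχ⟩, realize_onFormula_inclB]
    exact hy _ ⟨_, rfl⟩)
  have hB : SameType (langB L Eβ) (Sum.elim d fun _ : Unit => b) (Sum.elim d' fun _ => b') :=
    SameType.of_imp fun θ hθ => (realize_onFormula_inclB θ _).1 (hb' _ ⟨θ, hθ, rfl⟩)
  -- If `b'` were in `A`, going back would give a solution `b''` of `φ` in `A`. It is already a
  -- component `d i`, which forces `d' i = b'` and then `d i = b`, although `b` is not in `A`.
  have hb'A : b' ∉ setA N := fun hb'A => by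
    obtain ⟨b'', hb'', hg⟩ := hd.symm.exists_snoc_mem hβ hT hκ hsM hb'A
    have hφ'' : φ.Realize (Sum.elim (d ∘ f) fun _ => b'') := by
      have h₁ := (hB (φ.relabel (Sum.map f id))).1 (by
        rw [Formula.realize_relabel, Sum.elim_comp_map]
        exact hφ)
      have h₂ := (hg.elemB (φ.relabel (Sum.map f id))).1 h₁
      rw [Formula.realize_relabel, Sum.elim_comp_map] at h₂
      exact h₂
    obtain ⟨i, hi⟩ := hF ⟨hφ'', hb''⟩
    have h₁ : d' i = b' := (hg.elemB.eq_iff (Sum.inl i) (Sum.inr ())).2 hi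
    have h₂ : d i = b := (hB.eq_iff (Sum.inl i) (Sum.inr ())).2 h₁
    exact hb (h₂ ▸ hi ▸ hb'')
  have hacl'' : b' ∈ acl (langB L Eβ) (Set.range d') := by
    have := hB.mem_acl (i := Sum.inr ()) (f := Sum.inl) (by rwa [Sum.elim_comp_inl])
    rwa [Sum.elim_comp_inl] at this
  obtain ⟨pos, E, h₁, h₂⟩ := hd.free
  exact Good.hasExtension_snoc (b' := b')
    { elemB := hB
      elemA := sameType_structA_snoc hd.elemA hb
      free := ⟨_, _, h₁.snoc_of_mem_acl pM hb hacl', h₂.snoc_of_mem_acl pN hb'A hacl''⟩ }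

/-- An element not algebraic over `A` and the tuple. -/
theorem Good.hasExtension_of_notMem_acl (hβ : IsGeometric.{u, v, w} Tβ)
    (hT : IsMLTheory.{u, v, w} Tβ Tα T) {κ : Cardinal.{max u v w}}
    (hκ : Cardinal.lift.{w} (max ℵ₀ (lang2 L Eβ Eα).card) < κ)
    (hsN : IsSaturated (L := lang2 L Eβ Eα) N κ)
    (h : Good hM hN c c') (hacl : b ∉ acl (langB L Eβ) (setA M ∪ Set.range c)) :
    HasExtension hM hN c c' {b} := by
  have hκ' : ℵ₀ ≤ κ := by
    refine le_trans ?_ hκ.le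
    rw [Cardinal.aleph0_le_lift]
    exact le_max_left _ _
  have pM := isPregeometry_acl hβ hM
  have pN := isPregeometry_acl hβ hN
  choose s hsc using fun z : Set.range c' => z.2
  obtain ⟨b', hb', hq⟩ := hT.codensity N κ hκ hsN (Set.range c')
    ((Cardinal.lt_aleph0_iff_set_finite.2 (Set.finite_range c')).trans_le hκ')
    (pullType (langB L Eβ) s c b) (isType_pullType h.elemB hsc)
    (nonAlgebraic_pullType h.elemB hsc fun hmem =>
      hacl (pM.mono _ _ Set.subset_union_right hmem))
  obtain ⟨pos, E, h₁, h₂⟩ := h.free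
  exact Good.hasExtension_snoc (b' := b')
    { elemB := sameType_of_pullType h.elemB hsc (fun i => ⟨i, rfl⟩) hq
      elemA := sameType_structA_snoc h.elemA fun hb => hacl (pM.subset_cl _ (Or.inl hb))
      free := ⟨_, _, h₁.snoc_of_notMem_acl pM hacl, h₂.snoc_of_notMem_acl pN hb'⟩ }

theorem Good.hasExtension_singleton [M ⊨ T] (hβ : IsGeometric.{u, v, w} Tβ)
    (hT : IsMLTheory.{u, v, w} Tβ Tα T) {κ : Cardinal.{max u v w}}
    (hκ : Cardinal.lift.{w} (max ℵ₀ (lang2 L Eβ Eα).card) < κ)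
    (hsM : IsSaturated (L := lang2 L Eβ Eα) M κ) (hsN : IsSaturated (L := lang2 L Eβ Eα) N κ)
    (h : Good hM hN c c') (b : M) : HasExtension hM hN c c' {b} := by
  have pM := isPregeometry_acl hβ hM
  by_cases hb : b ∈ setA M
  · exact (h.exists_snoc_mem hβ hT hκ hsN hb).choose_spec.2.hasExtension_snoc
  by_cases hacl : b ∈ acl (langB L Eβ) (setA M ∪ Set.range c)
  -- Adding the finitely many elements of `A` that are involved makes `b` algebraic over the tuple
  -- itself.
  · obtain ⟨F, hF, hFfin, hbF⟩ := pM.finitary _ _ hacl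
    obtain ⟨ι', hι', d, d', f, hd, rfl, rfl, hFd⟩ := h.hasExtension_of_finite (· ∈ setA M)
      (fun h _ hb => (h.exists_snoc_mem hβ hT hκ hsN hb).choose_spec.2.hasExtension_snoc)
      (hFfin.inter_of_left (setA M)) fun _ hx => hx.2
    refine HasExtension.trans (hd.hasExtension_of_mem_acl hβ hT hκ hsM hsN hb ?_)
    refine pM.mono _ _ (fun x hx => ?_) hbF
    rcases hF hx with hxA | hxc
    · exact hFd ⟨hx, hxA⟩
    · exact Set.range_comp_subset_range f d hxc
  · exact h.hasExtension_of_notMem_acl hβ hT hκ hsN hacl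

theorem Good.hasExtension [M ⊨ T] (hβ : IsGeometric.{u, v, w} Tβ)
    (hT : IsMLTheory.{u, v, w} Tβ Tα T) {κ : Cardinal.{max u v w}}
    (hκ : Cardinal.lift.{w} (max ℵ₀ (lang2 L Eβ Eα).card) < κ)
    (hsM : IsSaturated (L := lang2 L Eβ Eα) M κ) (hsN : IsSaturated (L := lang2 L Eβ Eα) N κ)
    (h : Good hM hN c c') {F : Set M} (hF : F.Finite) : HasExtension hM hN c c' F :=
  h.hasExtension_of_finite (fun _ => True)
    (fun h b _ => h.hasExtension_singleton hβ hT hκ hsM hsN b) hF fun _ _ => trivial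

end BackAndForth

/-! ### Elementarity of inclusions of pairs -/

section Elementary

/-- A substructure that is the range of an embedding is elementary iff the embedding is. -/
theorem isElementary_iff_sameType {L : FirstOrder.Language.{u, v}} {P : Type w} {M : Type x}
    [L.Structure P] [L.Structure M] (i : P ↪[L] M) (K : L.Substructure M)
    (hK : (K : Set M) = Set.range i) : K.IsElementary ↔ SameType L (fun p : P => p) i := by
  obtain rfl : K = i.toHom.range := SetLike.coe_injective (hK.trans (i.toHom.range_coe).symm)
  constructor
  · intro h φ
    let K' : L.ElementarySubstructure M := ⟨_, h⟩
    exact (StrongHomClass.realize_formula i.equivRange φ).symm.trans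
      (K'.subtype.map_formula φ fun p => i.equivRange p).symm
  · intro h n φ a
    have ha : a = fun k => i.equivRange (i.equivRange.symm (a k)) := by
      funext k
      exact (i.equivRange.apply_symm_apply (a k)).symm
    rw [ha]
    exact ((h.comp fun k => i.equivRange.symm (a k)) φ).symm.trans
      (StrongHomClass.realize_formula i.equivRange φ).symm

variable {L Eβ Eα : FirstOrder.Language.{u, v}}

/-- Splitting an arbitrary `L²`-structure into its four parts makes the statements about pairs
applicable to it. -/
theorem exists_sumStructure (P : Type w) (st : (lang2 L Eβ Eα).Structure P) :
    ∃ (_ : L.Structure P) (_ : Eβ.Structure P) (_ : Eα.Structure P) (_ : predLang.Structure P),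
      st = Language.sumStructure (L.sum Eβ) (Eα.sum predLang) P := by
  refine ⟨((LHom.sumInl : langB L Eβ →ᴸ lang2 L Eβ Eα).comp LHom.sumInl).reduct P,
    ((LHom.sumInl : langB L Eβ →ᴸ lang2 L Eβ Eα).comp LHom.sumInr).reduct P,
    ((LHom.sumInr : Eα.sum predLang →ᴸ lang2 L Eβ Eα).comp LHom.sumInl).reduct P,
    ((LHom.sumInr : Eα.sum predLang →ᴸ lang2 L Eβ Eα).comp LHom.sumInr).reduct P, ?_⟩
  refine Structure.ext ?_ ?_
  · funext n f x
    rcases f with (f | f) | (f | f) <;> rfl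
  · funext n R x
    rcases R with (R | R) | (R | R) <;> rfl

theorem exists_isSaturated_pair (M : Type (max u v w)) [L.Structure M] [Eβ.Structure M]
    [Eα.Structure M] [predLang.Structure M] [Nonempty M] (κ : Cardinal.{max u v w})
    (hκ : ℵ₀ ≤ κ) :
    ∃ (N : Type (max u v w)) (_ : L.Structure N) (_ : Eβ.Structure N) (_ : Eα.Structure N)
      (_ : predLang.Structure N), Nonempty (M ↪ₑ[lang2 L Eβ Eα] N) ∧
        IsSaturated (L := lang2 L Eβ Eα) N (Order.succ κ) := by
  obtain ⟨N, st, hj, hs⟩ := exists_isSaturated_extension.{u, v, w} (lang2 L Eβ Eα) M κ hκ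
  obtain ⟨a, b, c, d, rfl⟩ := exists_sumStructure N st
  exact ⟨N, a, b, c, d, hj, hs⟩

/-- Neither `Eα` nor the language of `A` has function symbols. -/
theorem exists_onTerm_inclB_eq [Eα.IsRelational] {γ : Type x} (t : (lang2 L Eβ Eα).Term γ) :
    ∃ t₀ : (langB L Eβ).Term γ, (inclB L Eβ Eα).onTerm t₀ = t := by
  induction t with
  | var k => exact ⟨Term.var k, rfl⟩
  | @func n f ts ih =>
    choose ts₀ hts₀ using ih
    rcases f with f | f | f
    · exact ⟨Term.func f ts₀, by rw [LHom.onTerm, funext hts₀]; rfl⟩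
    · exact isEmptyElim f
    · exact f.elim

/-! ### Atomic formulas and corresponding tuples -/

section Atomic

variable {Tβ : (langB L Eβ).Theory} {Tα : (langA L Eα).Theory}
variable {M : Type w} [L.Structure M] [Eβ.Structure M] [Eα.Structure M] [predLang.Structure M]
variable {N : Type x} [L.Structure N] [Eβ.Structure N] [Eα.Structure N] [predLang.Structure N]
variable {hM : M ⊨ pairTheory Tβ Tα} {hN : N ⊨ pairTheory Tβ Tα}
variable {ι : Type} {c : ι → M} {c' : ι → N}

theorem Good.realize_term_eq_iff [Eα.IsRelational] (h : Good hM hN c c')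
    (t₁ t₂ : (lang2 L Eβ Eα).Term ι) : t₁.realize c = t₂.realize c ↔
      t₁.realize c' = t₂.realize c' := by
  obtain ⟨t₁, rfl⟩ := exists_onTerm_inclB_eq t₁
  obtain ⟨t₂, rfl⟩ := exists_onTerm_inclB_eq t₂
  simpa only [LHom.realize_onTerm, Formula.realize_equal] using h.elemB (t₁.equal t₂)

/-- The types in `𝓐` control relations of `Eα` only on tuples from `A`; elsewhere these relations
fail by the support axioms. -/
theorem Good.relMap_iff (h : Good hM hN c c') {n : ℕ} (R : (lang2 L Eβ Eα).Relations n)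
    (k : Fin n → ι) : Structure.RelMap R (c ∘ k) ↔ Structure.RelMap R (c' ∘ k) := by
  rcases R with R | R | R
  · exact h.elemB (Relations.formula R fun i => Term.var (k i))
  · have key : ∀ (hc : ∀ i, c (k i) ∈ setA M) (hc' : ∀ i, c' (k i) ∈ setA N),
        Structure.RelMap R (c ∘ k) ↔ Structure.RelMap R (c' ∘ k) := fun hc hc' =>
      h.elemA k (fun i => ⟨c (k i), hc i⟩) (fun i => ⟨c' (k i), hc' i⟩) (fun _ => rfl)
        (fun _ => rfl) (Relations.formula (L := langA L Eα) (Sum.inr R) fun i => Term.var i)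
    constructor
    · intro hR
      have hc := mem_setA_of_relMap hM R (c ∘ k) hR
      exact (key hc fun i => (h.mem_iff _).1 (hc i)).1 hR
    · intro hR
      have hc := mem_setA_of_relMap hN R (c' ∘ k) hR
      exact (key (fun i => (h.mem_iff _).2 (hc i)) hc).2 hR
  · cases R
    have e : ∀ {K : Type _} (d : Fin 1 → K), d = ![d 0] := fun d => by
      funext i; rw [Subsingleton.elim i 0]; rfl
    have e' : c' ∘ k = ![c' (k 0)] := by funext i; rw [Subsingleton.elim i 0]; rfl
    rw [e (c ∘ k), e']
    exact h.mem_iff (k 0)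

end Atomic

/-! ### Corresponding tuples have the same type of pairs -/

section Main

variable {Tβ : (langB L Eβ).Theory} {Tα : (langA L Eα).Theory} {T : (lang2 L Eβ Eα).Theory}
variable {M : Type (max u v w)} [L.Structure M] [Eβ.Structure M] [Eα.Structure M]
  [predLang.Structure M] [Nonempty M] [M ⊨ T]
variable {N : Type (max u v w)} [L.Structure N] [Eβ.Structure N] [Eα.Structure N]
  [predLang.Structure N] [Nonempty N] [N ⊨ T]
variable {hM : M ⊨ pairTheory Tβ Tα} {hN : N ⊨ pairTheory Tβ Tα}

/-- Corresponding tuples in saturated models satisfy the same formulas. -/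
theorem Good.realize_iff [Eα.IsRelational] (hβ : IsGeometric.{u, v, w} Tβ)
    (hT : IsMLTheory.{u, v, w} Tβ Tα T) {κ : Cardinal.{max u v w}}
    (hκ : Cardinal.lift.{w} (max ℵ₀ (lang2 L Eβ Eα).card) < κ)
    (hsM : IsSaturated (L := lang2 L Eβ Eα) M κ) (hsN : IsSaturated (L := lang2 L Eβ Eα) N κ)
    {γ : Type} {n : ℕ} (φ : (lang2 L Eβ Eα).BoundedFormula γ n) :
    ∀ {ι : Type} [Finite ι] {c : ι → M} {c' : ι → N}, Good hM hN c c' → ∀ (f : γ → ι)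
      (g : Fin n → ι), φ.Realize (c ∘ f) (c ∘ g) ↔ φ.Realize (c' ∘ f) (c' ∘ g) := by
  induction φ with
  | falsum => exact fun _ _ _ => Iff.rfl
  | equal t₁ t₂ =>
    intro ι _ c c' h f g
    have := h.realize_term_eq_iff (t₁.relabel (Sum.elim f g)) (t₂.relabel (Sum.elim f g))
    simpa only [BoundedFormula.Realize, Term.realize_relabel, Sum.comp_elim] using this
  | rel R ts =>
    intro ι _ c c' h f g
    simp only [BoundedFormula.Realize, ← Sum.comp_elim]
    -- The values of the terms are added to the tuple, which reduces the atomic formula to a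
    -- relation between components.
    obtain ⟨ι', _, d, d', e, hd, rfl, rfl, hF⟩ := h.hasExtension hβ hT hκ hsM hsN
      (Set.finite_range fun i => (ts i).realize (c ∘ Sum.elim f g))
    choose k hk using fun i => hF ⟨i, rfl⟩
    have hk' : ∀ i, d' (k i) = (ts i).realize ((d' ∘ e) ∘ Sum.elim f g) := fun i => by
      have := hd.realize_term_eq_iff (Term.var (k i)) ((ts i).relabel (e ∘ Sum.elim f g))
      simp only [Term.realize_var, Term.realize_relabel] at this
      exact this.1 (hk i)
    rw [← funext hk, ← funext hk']
    exact hd.relMap_iff R k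
  | imp φ₁ φ₂ ih₁ ih₂ =>
    intro ι _ c c' h f g
    simp only [BoundedFormula.Realize, ih₁ h, ih₂ h]
  | all φ ih =>
    intro ι _ c c' h f g
    simp only [BoundedFormula.realize_all]
    constructor
    · intro hall b'
      obtain ⟨ι', _, d', d, e, hd, rfl, rfl, hF⟩ :=
        h.symm.hasExtension hβ hT hκ hsN hsM (Set.finite_singleton b')
      obtain ⟨k, rfl⟩ := hF rfl
      have := (ih hd.symm (e ∘ f) (Fin.snoc (e ∘ g) k)).1 (by
        rw [Fin.comp_snoc]
        exact hall (d k))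
      rwa [Fin.comp_snoc] at this
    · intro hall b
      obtain ⟨ι', _, d, d', e, hd, rfl, rfl, hF⟩ :=
        h.hasExtension hβ hT hκ hsM hsN (Set.finite_singleton b)
      obtain ⟨k, rfl⟩ := hF rfl
      have := (ih hd (e ∘ f) (Fin.snoc (e ∘ g) k)).2 (by
        rw [Fin.comp_snoc]
        exact hall (d' k))
      rwa [Fin.comp_snoc] at this

/-- Corresponding tuples satisfy the same formulas. -/
theorem Good.sameType [Eα.IsRelational] (hβ : IsGeometric.{u, v, w} Tβ)
    (hT : IsMLTheory.{u, v, w} Tβ Tα T) {ι : Type} [Finite ι] {c : ι → M} {c' : ι → N}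
    (h : Good hM hN c c') : SameType (lang2 L Eβ Eα) c c' := by
  have hκ : ℵ₀ ≤ Cardinal.lift.{w} (max ℵ₀ (lang2 L Eβ Eα).card) := by
    rw [Cardinal.aleph0_le_lift]
    exact le_max_left _ _
  -- Density and codensity speak only of saturation beyond $|T^2|$, so the comparison takes place in
  -- $|T^2|^+$-saturated elementary extensions, to which the correspondence is carried by
  -- `Good.map`.
  obtain ⟨M', _, _, _, _, ⟨j⟩, hsM⟩ := exists_isSaturated_pair.{u, v, w} (L := L) (Eβ := Eβ)
    (Eα := Eα) M _ hκ
  obtain ⟨N', _, _, _, _, ⟨j'⟩, hsN⟩ := exists_isSaturated_pair.{u, v, w} (L := L) (Eβ := Eβ)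
    (Eα := Eα) N _ hκ
  have : Nonempty M' := ⟨j (Classical.arbitrary M)⟩
  have : Nonempty N' := ⟨j' (Classical.arbitrary N)⟩
  have : M' ⊨ T := (j.theory_model_iff T).1 ‹_›
  have : N' ⊨ T := (j'.theory_model_iff T).1 ‹_›
  have hM' := hT.extends_pairTheory.model (M := M')
  have hN' := hT.extends_pairTheory.model (M := N')
  have h' : Good hM' hN' (j ∘ c) (j' ∘ c') :=
    ((h.map (isPregeometry_acl hβ hM) (isPregeometry_acl hβ hM') j).symm.map
      (isPregeometry_acl hβ hN) (isPregeometry_acl hβ hN') j').symm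
  intro φ
  rw [← j.map_formula φ, ← j'.map_formula φ, Formula.Realize, Formula.Realize]
  have key := h'.realize_iff hβ hT (Order.lt_succ _) hsM hsN φ id Fin.elim0
  rw [Subsingleton.elim (default : Fin 0 → M') ((j ∘ c) ∘ Fin.elim0),
    Subsingleton.elim (default : Fin 0 → N') ((j' ∘ c') ∘ Fin.elim0)]
  exact key

end Main

end Elementary

/-! ### Embeddings between models of an ML-theory -/

section Inclusion

variable {L Eβ Eα : FirstOrder.Language.{u, v}}
variable {Tβ : (langB L Eβ).Theory} {Tα : (langA L Eα).Theory}

section General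

variable {P : Type w} [L.Structure P] [Eβ.Structure P] [Eα.Structure P] [predLang.Structure P]
variable {M : Type x} [L.Structure M] [Eβ.Structure M] [Eα.Structure M] [predLang.Structure M]

/-- An embedding for a language is one for each smaller language. -/
def reductEmbedding {L' L : FirstOrder.Language.{u, v}} (e : L' →ᴸ L) {P : Type w} {M : Type x}
    [L'.Structure P] [L.Structure P] [e.IsExpansionOn P] [L'.Structure M] [L.Structure M]
    [e.IsExpansionOn M] (i : P ↪[L] M) : P ↪[L'] M where
  toEmbedding := i.toEmbedding
  map_fun' f a := by
    rw [← e.map_onFunction, ← e.map_onFunction]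
    exact i.map_fun _ _
  map_rel' R a := by
    rw [← e.map_onRelation, ← e.map_onRelation]
    exact i.map_rel _ _

/-- The embedding of `L_β`-structures underlying an embedding of pairs. -/
def embB (i : P ↪[lang2 L Eβ Eα] M) : P ↪[langB L Eβ] M :=
  reductEmbedding (inclB L Eβ Eα) i

theorem embedding_mem_setA_iff (i : P ↪[lang2 L Eβ Eα] M) (p : P) :
    i p ∈ setA M ↔ p ∈ setA P := by
  have h := i.map_rel (predA L Eβ Eα) ![p]
  have e : (i ∘ ![p] : Fin 1 → M) = ![i p] := by
    funext k; rw [Subsingleton.elim k 0]; rfl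
  rw [e] at h
  exact h

variable {hP : P ⊨ pairTheory Tβ Tα} {hM : M ⊨ pairTheory Tβ Tα}

/-- The embedding of `L_α`-structures induced by an embedding of pairs. -/
def embA (hP : P ⊨ pairTheory Tβ Tα) (hM : M ⊨ pairTheory Tβ Tα) (i : P ↪[lang2 L Eβ Eα] M) :
    structA hP ↪[langA L Eα] structA hM where
  toFun p := ⟨i p, (embedding_mem_setA_iff i p).2 p.2⟩
  inj' _ _ h := Subtype.ext (i.injective (Subtype.ext_iff.1 h))
  map_fun' f a := Subtype.ext
    ((reductEmbedding (inclA L Eβ Eα) i).map_fun f fun k => (a k : P))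
  map_rel' R a := (reductEmbedding (inclA L Eβ Eα) i).map_rel R fun k => (a k : P)

theorem sameType_embA (i : P ↪[lang2 L Eβ Eα] M)
    (h : SameType (lang2 L Eβ Eα) (fun p : P => p) i) :
    SameType (langA L Eα) (fun p : structA hP => p) (embA hP hM i) := fun θ => by
  rw [← realize_relFormula_structA, ← realize_relFormula_structA]
  exact h.comp (fun p : structA hP => (p : P)) (relFormula Eβ θ)

/-- A dependence over `A` between elements of the small model is reflected to one over its own
predicate, and its image is a dependence over $A'$. -/
theorem indepOver_of_sameType (pP : IsPregeometry (acl (langB L Eβ) : Set P → Set P))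
    (pM : IsPregeometry (acl (langB L Eβ) : Set M → Set M)) (i : P ↪[lang2 L Eβ Eα] M)
    (h : SameType (lang2 L Eβ Eα) (fun p : P => p) i) :
    IndepOver (langB L Eβ) (Set.range i) (setA M) (setA M ∩ Set.range i) := by
  let j : P ↪ₑ[lang2 L Eβ Eα] M := ⟨i, fun n φ a => ((h.comp a) φ).symm⟩
  intro S hS hi b hb hcl
  obtain ⟨X, rfl⟩ := Set.subset_range_iff_exists_image_eq.1 hS
  obtain ⟨x, hx, rfl⟩ := hb
  rw [Set.union_eq_self_of_subset_right Set.inter_subset_left, ← Set.image_singleton,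
    ← Set.image_sdiff i.injective] at hcl
  have h₁ : x ∈ acl (langB L Eβ) (setA P ∪ X \ {x}) :=
    mem_acl_setA_of_elementaryEmbedding pM pP j hcl
  have h₂ : i x ∈ acl (langB L Eβ) (i '' (setA P ∪ X \ {x})) := by
    refine h.langB.mem_acl_image (i := x) ?_
    rwa [Set.image_id']
  refine hi _ ⟨x, hx, rfl⟩ (pM.mono _ _ ?_ h₂)
  rintro _ ⟨y, hy | hy, rfl⟩
  · exact Or.inl ⟨(embedding_mem_setA_iff i y).2 hy, y, rfl⟩
  · exact Or.inr ⟨⟨y, hy.1, rfl⟩, fun e => hy.2 (i.injective e)⟩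

/-- Each finite tuple of a free elementary subpair extends to one that corresponds to itself. -/
theorem exists_good_extension
    (pM : IsPregeometry (acl (langB L Eβ) : Set M → Set M)) (i : P ↪[lang2 L Eβ Eα] M)
    (hB : SameType (langB L Eβ) (fun p : P => p) i)
    (hA : SameType (langA L Eα) (fun p : structA hP => p) (embA hP hM i))
    (hI : IndepOver (langB L Eβ) (Set.range i) (setA M) (setA M ∩ Set.range i))
    {n : ℕ} (a : Fin n → P) :
    ∃ (m : ℕ) (z : Fin m → P), Good hP hM (Sum.elim a z) (i ∘ Sum.elim a z) := by
  classical
  obtain ⟨E₀, hE₀, hind, hsp⟩ := exists_basis pM (Set.finite_range (i ∘ a))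
    (setA M ∩ Set.range i)
  -- The freeness hypothesis enters here: the basis over $A'$ stays independent over $A$.
  have hindA := hI E₀ (hE₀.trans (Set.range_comp_subset_range _ _)) hind
  rw [Set.union_eq_self_of_subset_right Set.inter_subset_left] at hindA
  choose F hF hFfin hFa using fun k => pM.finitary _ _ (hsp ⟨k, rfl⟩)
  -- Only finitely many elements of $A'$ are needed to span `a` over the basis; they become the
  -- added components `z`.
  have hD : ((⋃ k, F k) ∩ (setA M ∩ Set.range i)).Finite :=
    (Set.finite_iUnion hFfin).inter_of_left _
  obtain ⟨m, z₀, hz₀⟩ := hD.fin_embedding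
  choose z hz using fun k => (hz₀.subset ⟨k, rfl⟩ : z₀ k ∈ _).2.2
  let c : Fin n ⊕ Fin m → P := Sum.elim a z
  let pos : Set (Fin n ⊕ Fin m) := {k | c k ∈ setA P}
  let E : Set (Fin n ⊕ Fin m) := Sum.inl '' ((i ∘ a) ⁻¹' E₀)
  have hE : (i ∘ c) '' E = E₀ := by
    rw [← Set.image_comp, Function.comp_assoc, Sum.elim_comp_inl,
      Set.image_preimage_eq_of_subset hE₀]
  have hM' : FreeTuple L Eβ pos E (i ∘ c) :=
    { mem_iff := fun k => embedding_mem_setA_iff i (c k)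
      indep := by rwa [hE]
      span := fun k => by
        cases k with
        | inl k =>
          refine pM.mono _ _ (fun y hy => ?_) (hFa k)
          rw [Set.image_union, hE]
          rcases hF k hy with hyA | hyE
          · obtain ⟨l, rfl⟩ : y ∈ Set.range z₀ :=
              hz₀ ▸ ⟨Set.mem_iUnion_of_mem k hy, hyA⟩
            refine Or.inl ⟨Sum.inr l, ?_, hz l⟩
            exact (embedding_mem_setA_iff i (z l)).1 ((hz l).symm ▸ hyA.1)
          · exact Or.inr hyE
        | inr l =>
          refine pM.subset_cl _ ⟨Sum.inr l, Or.inl ?_, rfl⟩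
          exact (embedding_mem_setA_iff i (z l)).1
            ((hz l).symm ▸ (hz₀.subset ⟨l, rfl⟩ : z₀ l ∈ _).2.1) }
  have hBc : SameType (langB L Eβ) c (i ∘ c) := hB.comp c
  have hP' : FreeTuple L Eβ pos E c :=
    { mem_iff := fun k => Iff.rfl
      indep := by
        -- A dependence over the predicate of `P` would be carried by the `L_β`-elementary map `i`
        -- to one over the larger set `setA M`.
        intro b hb hcl
        have h₁ : i b ∈ acl (langB L Eβ) (i '' (setA P ∪ c '' E \ {b})) := by
          refine hB.mem_acl_image (i := b) ?_
          rwa [Set.image_id']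
        refine hM'.indep (i b) ?_ (pM.mono _ _ ?_ h₁)
        · rw [Set.image_comp]
          exact ⟨b, hb, rfl⟩
        · rintro _ ⟨y, hy | hy, rfl⟩
          · exact Or.inl ((embedding_mem_setA_iff i y).2 hy)
          · rw [Set.image_comp]
            exact Or.inr ⟨⟨y, hy.1, rfl⟩, fun e => hy.2 (i.injective e)⟩
      span := fun k => hBc.symm.mem_acl_image (hM'.span k) }
  refine ⟨m, z, hBc, fun f x x' hx hx' => ?_, pos, E, hP', hM'⟩
  have e : x' = embA hP hM i ∘ x := by
    funext k
    refine Subtype.ext ((hx' k).trans ?_)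
    exact congrArg i (hx k).symm
  rw [e]
  exact hA.comp x

end General

/-- An inclusion of models of an ML-theory is elementary iff both of its components are and it is
free. -/
theorem sameType_iff_of_isMLTheory [Eα.IsRelational] {T : (lang2 L Eβ Eα).Theory}
    {P : Type (max u v w)} [L.Structure P] [Eβ.Structure P] [Eα.Structure P]
    [predLang.Structure P] [Nonempty P] [P ⊨ T]
    {M : Type (max u v w)} [L.Structure M] [Eβ.Structure M] [Eα.Structure M]
    [predLang.Structure M] [Nonempty M] [M ⊨ T] (hβ : IsGeometric.{u, v, w} Tβ)
    (hT : IsMLTheory.{u, v, w} Tβ Tα T) (hP : P ⊨ pairTheory Tβ Tα) (hM : M ⊨ pairTheory Tβ Tα)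
    (i : P ↪[lang2 L Eβ Eα] M) :
    SameType (lang2 L Eβ Eα) (fun p : P => p) i ↔
      SameType (langB L Eβ) (fun p : P => p) i ∧
      SameType (langA L Eα) (fun p : structA hP => p) (embA hP hM i) ∧
      IndepOver (langB L Eβ) (Set.range i) (setA M) (setA M ∩ Set.range i) := by
  have pP := isPregeometry_acl hβ hP
  have pM := isPregeometry_acl hβ hM
  constructor
  · exact fun h => ⟨h.langB, sameType_embA i h, indepOver_of_sameType pP pM i h⟩
  · rintro ⟨hB, hA, hI⟩
    have key : ∀ (n : ℕ) (φ : (lang2 L Eβ Eα).Formula (Fin n)) (a : Fin n → P),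
        φ.Realize (i ∘ a) ↔ φ.Realize a := by
      intro n φ a
      obtain ⟨m, z, hg⟩ := exists_good_extension pM i hB hA hI a
      have := (hg.sameType hβ hT).comp Sum.inl φ
      rw [Sum.elim_comp_inl, Function.comp_assoc, Sum.elim_comp_inl] at this
      exact this.symm
    exact sameType_of_elementaryEmbedding (⟨i, key⟩ : P ↪ₑ[lang2 L Eβ Eα] M) fun p => p

end Inclusion

end MLPair

theorem mainTheorem11 {L Eβ Eα : FirstOrder.Language.{u, v}} [Eα.IsRelational]
    (Tβ : (MLPair.langB L Eβ).Theory) (Tα : (MLPair.langA L Eα).Theory)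
    (T : (MLPair.lang2 L Eβ Eα).Theory)
    (hβ : MLPair.IsGeometric.{u, v, w} Tβ)
    (hT : MLPair.IsMLTheory.{u, v, w} Tβ Tα T)
    (M : Type (max u v w)) [L.Structure M] [Eβ.Structure M] [Eα.Structure M]
    [MLPair.predLang.Structure M] [Nonempty M] [M ⊨ T]
    (S : (MLPair.lang2 L Eβ Eα).Substructure M) [Nonempty S] [S ⊨ T] :
    S.IsElementary ↔
      (MLPair.subB S).IsElementary ∧
      (MLPair.subA S (hT.extends_pairTheory.model (M := M))).IsElementary ∧
      MLPair.IndepOver (MLPair.langB L Eβ) (S : Set M) (MLPair.setA M)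
        (MLPair.setA M ∩ (S : Set M)) := by
  -- The substructure is replaced by an abstract structure embedded in `M`, so that its
  -- `L²`-structure becomes a variable and can be replaced by a sum of its four parts.
  obtain ⟨P, st, _, _, i, hi⟩ : ∃ (P : Type (max u v w)) (st : (MLPair.lang2 L Eβ Eα).Structure P)
      (_ : Nonempty P) (_ : P ⊨ T) (i : P ↪[MLPair.lang2 L Eβ Eα] M),
      Set.range i = (S : Set M) :=
    ⟨S, inferInstance, inferInstance, inferInstance, S.subtype, Subtype.range_coe⟩
  obtain ⟨_, _, _, _, rfl⟩ := MLPair.exists_sumStructure P st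
  have hP := hT.extends_pairTheory.model (M := P)
  have hM := hT.extends_pairTheory.model (M := M)
  rw [← hi, MLPair.isElementary_iff_sameType i S hi.symm,
    MLPair.isElementary_iff_sameType (MLPair.embB i) (MLPair.subB S) hi.symm,
    MLPair.isElementary_iff_sameType (MLPair.embA hP hM i) (MLPair.subA S hM) (by
      ext y
      constructor
      · intro hy
        obtain ⟨p, hp⟩ : (y : M) ∈ Set.range i := hi ▸ hy
        exact ⟨⟨p, (MLPair.embedding_mem_setA_iff i p).1 (hp ▸ y.2)⟩, Subtype.ext hp⟩
      · rintro ⟨p, rfl⟩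
        exact hi.subset ⟨p, rfl⟩)]
  exact MLPair.sameType_iff_of_isMLTheory hβ hT hP hM i
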